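/- A mixed graph has a finite vertex set and finitely many edges, each of which is either undirected or directed; only mixed graphs whose underlying graph is simple are considered (no loops, and at most one edge, of either kind, between two vertices). An orientable path from $x$ to $y$ is a sequence of distinct vertices starting at $x$ and ending at $y$ in which every two consecutive vertices $x_i,x_{i+1}$ are joined by an undirected edge or by a directed edge from $x_i$ to $x_{i+1}$. A mixed graph is connected if for all vertices $x,y$ there is an orientable path from $x$ to $y$. A bridge is an undirected edge whose deletion disconnects the underlying graph, and a mixed graph is bridgeless if it is connected and has no bridge. For a vertex $u$ of $G$, let $d_G^+(u)$, $d_G^-(u)$ and $d_G^*(u)$ be the numbers of directed edges leaving $u$, of directed edges entering $u$, and of undirected edges incident with $u$. A strong orientation of $G$ assigns a direction to every undirected edge of $G$ so that the resulting directed graph is connected. The diameter of a directed graph is the maximum, over all ordered pairs $(x,y)$ of vertices, of the number of edges of a shortest directed path from $x$ to $y$, and $\overrightarrow{\mathrm{diam}}(G)$ is the minimum diameter of a strong orientation of $G$. **Theorem.** Let $G$ be a bridgeless mixed graph of order $n$. Then $G$ has a strong orientation, and for every $u\in V(G)$, \[ \overrightarrow{\mathrm{diam}}(G)\le \begin{cases}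 n-d_G^*(u)+3, & \text{if } G \text{ is undirected, or if } d_G^+(u)+d_G^-(u)\ge 2,\\ & \text{or if } d_G^*(u)=5 \text{ and } d_G^+(u)+d_G^-(u)=1;\\ n-d_G^*(u)+4, & \text{otherwise.} \end{cases} \] -/

import Mathlib

/-- A mixed graph on the vertex set `V` whose underlying graph is simple: `und` is the graph of the
undirected edges, and `arc x y` says that there is a directed edge from `x` to `y`. There are no
loops, and two vertices are joined by at most one edge, which is either undirected or directed in
exactly one of the two directions (`arc_asymm` also excludes directed loops). -/
@[ext]
structure MixedGraph (V : Type*) where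
  und : SimpleGraph V
  arc : V → V → Prop
  arc_asymm : ∀ x y, arc x y → ¬ arc y x
  arc_not_und : ∀ x y, arc x y → ¬ und.Adj x y

namespace MixedGraph

variable {V : Type*}

/-- One may pass from `x` to `y` along an undirected edge or along a directed edge from `x` to `y`. -/
def Step (G : MixedGraph V) (x y : V) : Prop :=
  G.und.Adj x y ∨ G.arc x y

/-- The list `l` of pairwise distinct vertices is an orientable path from `x` to `y`. -/
structure IsOrientablePath (G : MixedGraph V) (l : List V) (x y : V) : Prop where
  nodup : l.Nodup
  chain : l.IsChain G.Step
  head : l.head? = some x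
  last : l.getLast? = some y

/-- A mixed graph is (strongly) connected if there is an orientable path from every vertex to every
vertex. -/
def Connected (G : MixedGraph V) : Prop :=
  ∀ x y : V, ∃ l : List V, G.IsOrientablePath l x y

/-- The distance from `x` to `y`: the least number of edges of an orientable path from `x` to `y`
(`⊤` if there is none). -/
noncomputable def dist (G : MixedGraph V) (x y : V) : ℕ∞ :=
  ⨅ (l : List V) (_ : G.IsOrientablePath l x y), ((l.length - 1 : ℕ) : ℕ∞)

/-- The diameter: the largest distance from a vertex to a vertex. -/
noncomputable def diam (G : MixedGraph V) : ℕ∞ :=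
  ⨆ (x : V) (y : V), G.dist x y

/-- The underlying simple graph, in which directions are forgotten. -/
def underlying (G : MixedGraph V) : SimpleGraph V where
  Adj x y := G.und.Adj x y ∨ G.arc x y ∨ G.arc y x
  symm := ⟨by
    rintro x y (h | h | h)
    · exact Or.inl h.symm
    · exact Or.inr (Or.inr h)
    · exact Or.inr (Or.inl h)⟩
  loopless := ⟨by
    rintro x (h | h | h)
    · exact G.und.loopless.irrefl x h
    · exact G.arc_asymm x x h h
    · exact G.arc_asymm x x h h⟩

/-- `G - e` for an undirected edge `e`. -/
def deleteUndEdge (G : MixedGraph V) (e : Sym2 V) : MixedGraph V where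
  und := G.und.deleteEdges {e}
  arc := G.arc
  arc_asymm := G.arc_asymm
  arc_not_und x y h h' := G.arc_not_und x y h (SimpleGraph.deleteEdges_le {e} h')

/-- A bridge is an undirected edge whose deletion disconnects the underlying graph. -/
def IsBridge (G : MixedGraph V) (e : Sym2 V) : Prop :=
  e ∈ G.und.edgeSet ∧ ¬ (G.deleteUndEdge e).underlying.Connected

/-- A mixed graph is bridgeless if it is connected and has no bridge. -/
def Bridgeless (G : MixedGraph V) : Prop :=
  G.Connected ∧ ∀ e : Sym2 V, ¬ G.IsBridge e

/-- Every edge is undirected. -/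
def IsUndirected (G : MixedGraph V) : Prop :=
  ∀ x y : V, ¬ G.arc x y

/-- Every edge is directed. -/
def IsDirected (G : MixedGraph V) : Prop :=
  ∀ x y : V, ¬ G.und.Adj x y

/-- The out-degree `d⁺(x)`. -/
noncomputable def outDeg (G : MixedGraph V) (x : V) : ℕ := {y : V | G.arc x y}.ncard

/-- The in-degree `d⁻(x)`. -/
noncomputable def inDeg (G : MixedGraph V) (x : V) : ℕ := {y : V | G.arc y x}.ncard

/-- The undirected degree `d*(x)`. -/
noncomputable def undDeg (G : MixedGraph V) (x : V) : ℕ := {y : V | G.und.Adj x y}.ncard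

/-- `D` is an orientation of `G`: every edge of `D` is directed, the directed edges of `G` are kept,
every undirected edge of `G` receives a direction (exactly one, by `D.arc_asymm`), and `D` has no
other edges. -/
structure IsOrientation (D G : MixedGraph V) : Prop where
  directed : D.IsDirected
  arc_of_arc : ∀ x y, G.arc x y → D.arc x y
  arc_of_und : ∀ x y, G.und.Adj x y → D.arc x y ∨ D.arc y x
  step_of_arc : ∀ x y, D.arc x y → G.Step x y

/-- A strong orientation is an orientation that is strongly connected. -/
def IsStrongOrientation (D G : MixedGraph V) : Prop :=
  D.IsOrientation G ∧ D.Connected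

/-- The oriented diameter: the least diameter of a strong orientation of `G`. It is `⊤` if `G` has
no strong orientation, so a finite upper bound includes the existence of a strong orientation. -/
noncomputable def orientedDiam (G : MixedGraph V) : ℕ∞ :=
  ⨅ (D : MixedGraph V) (_ : D.IsStrongOrientation G), D.diam

/-- The undirected degree is less than the order, so `n - d*(u)` is an honest subtraction. -/
theorem undDeg_lt_card [Fintype V] (G : MixedGraph V) (u : V) : G.undDeg u < Fintype.card V := by
  have h : {y : V | G.und.Adj u y} ⊂ Set.univ :=
    Set.ssubset_univ_iff.2 fun h => G.und.loopless.irrefl u (h ▸ Set.mem_univ u :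
      u ∈ {y : V | G.und.Adj u y})
  have h2 := Set.ncard_lt_ncard h
  rwa [Set.ncard_univ, Nat.card_eq_fintype_card] at h2

end MixedGraph

/-! Call the undirected neighbours of `u` the rim `N`. A walk confined to a vertex set contains a
path with no more vertices than that set, so a walk meeting at most `k` rim vertices gives distance
at most `n - d*(u) + k - 1`. Five rim vertices are therefore allowed for the bound with `+4`, and
four for the bound with `+3`; a vertex off the rim known to be missed pays for one further rim
vertex.

An undirected edge that is not a bridge can be bypassed in one direction (`Bridgeless.bypass`), so
it can be directed without losing bridgelessness. Directing all edges that miss `u` leaves a star at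
the hub `u`, and it remains to choose the set of rim vertices to which the hub points; the rest of
the rim points to the hub. `IsStarSystem.exists_isOutSet` makes this choice by minimality. Then the
hub is reached with at most three rim vertices and left with at most two, which gives `+4`.

When three rim vertices are needed, the walk to the hub misses all out-neighbours of the hub. This
saves a vertex if the hub has two out-neighbours. With one out-neighbour, and either an in-neighbour
or a rim of size five, the hub is also directed to a suitable set `L` of further rim vertices.
Reversing all arcs covers the remaining cases with directed edges at `u`.

For undirected graphs the order of choices is changed: ears at `u` are directed first, until they
cover the whole rim (`IsEarSystem`), so that at most two rim vertices are needed in either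
direction. The other edges are directed afterwards. -/

/-! ### Walks confined to a vertex set -/

/-- There is an `r`-walk from `x` to `y` all of whose vertices lie in `T`. -/
def ReachIn {V : Type*} (r : V → V → Prop) (T : Set V) (x y : V) : Prop :=
  x ∈ T ∧ Relation.ReflTransGen (fun a b => a ∈ T ∧ b ∈ T ∧ r a b) x y

namespace ReachIn

variable {V : Type*} {r r' : V → V → Prop} {T T' S : Set V} {x y z : V}

theorem refl (h : x ∈ T) : ReachIn r T x x := ⟨h, .refl⟩

theorem single (hx : x ∈ T) (hy : y ∈ T) (h : r x y) : ReachIn r T x y :=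
  ⟨hx, .single ⟨hx, hy, h⟩⟩

theorem trans (h : ReachIn r T x y) (h' : ReachIn r T y z) : ReachIn r T x z :=
  ⟨h.1, h.2.trans h'.2⟩

theorem mono_of_mem (h : ReachIn r T x y) (hr : ∀ a ∈ T, ∀ b ∈ T, r a b → r' a b) :
    ReachIn r' T x y :=
  ⟨h.1, h.2.lift id fun a b h => ⟨h.1, h.2.1, hr a h.1 b h.2.1 h.2.2⟩⟩

theorem mono (h : ReachIn r T x y) (hT : T ⊆ T') (hr : ∀ a b, r a b → r' a b) :
    ReachIn r' T' x y :=
  ⟨hT h.1, h.2.lift id fun a b h => ⟨hT h.1, hT h.2.1, hr a b h.2.2⟩⟩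

theorem mono_set (h : ReachIn r T x y) (hT : T ⊆ T') : ReachIn r T' x y :=
  h.mono hT fun _ _ h => h

theorem mono_rel (h : ReachIn r T x y) (hr : ∀ a b, r a b → r' a b) : ReachIn r' T x y :=
  h.mono subset_rfl hr

theorem mem_left (h : ReachIn r T x y) : x ∈ T := h.1

theorem mem_right (h : ReachIn r T x y) : y ∈ T := by
  rcases Relation.ReflTransGen.cases_tail h.2 with h' | ⟨_, _, h'⟩
  · exact h' ▸ h.1
  · exact h'.2.1

theorem flip (h : ReachIn r T x y) : ReachIn (fun a b => r b a) T y x := by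
  refine ⟨h.mem_right, ?_⟩
  exact h.2.swap.lift id fun a b h => ⟨h.2.1, h.1, h.2.2⟩

theorem tail (h : ReachIn r T x y) (hz : z ∈ T) (h' : r y z) : ReachIn r T x z :=
  h.trans (single h.mem_right hz h')

theorem head (hx : x ∈ T) (h' : r x y) (h : ReachIn r T y z) : ReachIn r T x z :=
  (single hx h.mem_left h').trans h

theorem of_reflTransGen (h : Relation.ReflTransGen r x y) : ReachIn r Set.univ x y :=
  ⟨trivial, h.lift id fun _ _ h => ⟨trivial, trivial, h⟩⟩

theorem reflTransGen (h : ReachIn r T x y) : Relation.ReflTransGen r x y :=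
  h.2.lift id fun _ _ h => h.2.2

/-- Induction along a walk, from its first vertex on. -/
theorem induction_tail {motive : V → Prop} (h : ReachIn r T x y) (refl : motive x)
    (tail : ∀ b c, ReachIn r T x b → c ∈ T → r b c → motive b → motive c) : motive y := by
  obtain ⟨hx, h⟩ := h
  induction h with
  | refl => exact refl
  | tail h1 h2 ih => exact tail _ _ ⟨hx, h1⟩ h2.2.1 h2.2.2 ih

/-- A walk avoids `S`, or it can be cut at its first vertex in `S`. -/
theorem avoid_or_first (h : ReachIn r T x y) (S : Set V) :
    ReachIn r (T \ S) x y ∨ ∃ s ∈ S, ReachIn r (insert s (T \ S)) x s := by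
  refine h.induction_tail (motive := fun y => ReachIn r (T \ S) x y ∨
    ∃ s ∈ S, ReachIn r (insert s (T \ S)) x s) ?_ ?_
  · by_cases hx : x ∈ S
    · exact .inr ⟨x, hx, .refl (Set.mem_insert _ _)⟩
    · exact .inl (.refl ⟨h.mem_left, hx⟩)
  · rintro b c - hc hbc (h1 | h1)
    · by_cases hcS : c ∈ S
      · exact .inr ⟨c, hcS, (h1.mono_set (Set.subset_insert _ _)).tail (Set.mem_insert _ _) hbc⟩
      · exact .inl (h1.tail ⟨hc, hcS⟩ hbc)
    · exact .inr h1

/-- A walk avoids `S`, or it can be cut at its last vertex in `S`. -/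
theorem avoid_or_last (h : ReachIn r T x y) (S : Set V) :
    ReachIn r (T \ S) x y ∨ ∃ s ∈ S, ReachIn r (insert s (T \ S)) s y := by
  rcases h.flip.avoid_or_first S with h | ⟨s, hs, h⟩
  · exact .inl h.flip
  · exact .inr ⟨s, hs, h.flip⟩

theorem exists_first (h : ReachIn r T x y) (hy : y ∈ S) :
    ∃ s ∈ S, ReachIn r (insert s (T \ S)) x s :=
  (h.avoid_or_first S).resolve_left fun h => h.mem_right.2 hy

theorem exists_last (h : ReachIn r T x y) (hx : x ∈ S) :
    ∃ s ∈ S, ReachIn r (insert s (T \ S)) s y :=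
  (h.avoid_or_last S).resolve_left fun h => h.mem_left.2 hx

/-- A walk avoids `Z`, or its part after the last visit to `Z` does not return to its start. -/
theorem avoid_last (h : ReachIn r T x y) (Z : Set V) (hx : x ∉ Z) :
    ReachIn r (T \ Z) x y ∨ ∃ z ∈ Z, ReachIn r (T \ {x}) z y := by
  have hxT := h.mem_left
  by_cases hd : ∃ z ∈ Z, z ∈ T
  swap
  · refine .inl (h.mono_set fun t ht => ⟨ht, fun hz => hd ⟨t, hz, ht⟩⟩)
  -- The walk is cut at its last vertex `s` in `insert x Z`: if `s = x`, the tail avoids `Z`;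
  -- otherwise the tail starts in `Z` and avoids `x`.
  have key : ∀ s ∈ insert x Z, ReachIn r (insert s (T \ insert x Z)) s y → s ∈ T →
      ReachIn r (T \ Z) x y ∨ ∃ z ∈ Z, ReachIn r (T \ {x}) z y := by
    rintro s (rfl | hs) h1 hsT
    · refine .inl (h1.mono_set ?_)
      rintro t (rfl | ⟨ht, ht'⟩)
      · exact ⟨hxT, hx⟩
      · exact ⟨ht, fun h => ht' (.inr h)⟩
    · refine .inr ⟨s, hs, h1.mono_set ?_⟩
      rintro t (rfl | ⟨ht, ht'⟩)
      · exact ⟨hsT, fun h => hx (h ▸ hs)⟩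
      · exact ⟨ht, fun h => ht' (.inl h)⟩
  obtain ⟨s, hs, h1⟩ := h.exists_last (S := (insert x Z) ∩ T) ⟨.inl rfl, hxT⟩
  refine key s hs.1 (h1.mono_set ?_) hs.2
  rintro t (rfl | ⟨ht, ht'⟩)
  · exact .inl rfl
  · exact .inr ⟨ht, fun h => ht' ⟨h, ht⟩⟩

/-- A walk avoids `Z`, or its part before the first visit to `Z` does not meet its end. -/
theorem avoid_first (h : ReachIn r T x y) (Z : Set V) (hy : y ∉ Z) :
    ReachIn r (T \ Z) x y ∨ ∃ z ∈ Z, ReachIn r (T \ {y}) x z := by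
  rcases h.flip.avoid_last Z hy with h | ⟨z, hz, h⟩
  · exact .inl h.flip
  · exact .inr ⟨z, hz, h.flip⟩

/-- Dropping everything before the last visit to `x` allows `x` to be removed from the confining
set; this drives the induction on `T.ncard` by which loops are erased. -/
theorem cons_cases (h : ReachIn r T x y) :
    y = x ∨ ∃ z, r x z ∧ ReachIn r (T \ {x}) z y := by
  refine h.induction_tail (motive := fun y => y = x ∨ ∃ z, r x z ∧ ReachIn r (T \ {x}) z y)
    (.inl rfl) ?_
  intro b c _ hc hbc ih
  by_cases hcx : c = x
  · exact .inl hcx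
  · right
    rcases ih with rfl | ⟨z, hz, h1⟩
    · exact ⟨c, hbc, .refl ⟨hc, hcx⟩⟩
    · exact ⟨z, hz, h1.tail ⟨hc, hcx⟩ hbc⟩

theorem exists_list [Finite V] (h : ReachIn r T x y) :
    ∃ l : List V, l.Nodup ∧ l.IsChain r ∧ l.head? = some x ∧ l.getLast? = some y ∧
      ∀ z ∈ l, z ∈ T := by
  induction hn : T.ncard generalizing T x with
  | zero =>
    rw [Set.ncard_eq_zero] at hn
    exact absurd h.mem_left (hn ▸ Set.notMem_empty x)
  | succ n ih =>
    rcases h.cons_cases with rfl | ⟨z, hz, h1⟩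
    · exact ⟨[y], by simp, by simp, by simp, by simp, by simpa using h.mem_left⟩
    · have hc : (T \ {x}).ncard = n := by
        rw [Set.ncard_sdiff_singleton_of_mem h.mem_left, hn]; rfl
      obtain ⟨l, hl1, hl2, hl3, hl4, hl5⟩ := ih h1 hc
      refine ⟨x :: l, ?_, ?_, by simp, ?_, ?_⟩
      · exact List.nodup_cons.2 ⟨fun hx => (hl5 x hx).2 rfl, hl1⟩
      · rw [List.isChain_cons]
        refine ⟨?_, hl2⟩
        intro w hw
        rw [hl3] at hw
        cases hw
        exact hz
      · rw [List.getLast?_cons, hl4]; rfl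
      · intro w hw
        rcases List.mem_cons.1 hw with rfl | hw
        · exact h.mem_left
        · exact (hl5 w hw).1

/-- A walk contains a path, given here as a relation `o` on a set `P`. -/
theorem exists_path [Finite V] (h : ReachIn r T x y) :
    ∃ (P : Set V) (o : V → V → Prop), P ⊆ T ∧ x ∈ P ∧ y ∈ P ∧
      (∀ a b, o a b → a ∈ P ∧ b ∈ P ∧ r a b) ∧ (∀ a b, o a b → ¬ o b a) ∧
      ReachIn o P x y ∧ (∀ z ∈ P, z ≠ x → ReachIn o (P \ {x}) z y) ∧
      (∀ z ∈ P, z ≠ y → ReachIn o (P \ {y}) x z) := by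
  induction hn : T.ncard generalizing T x with
  | zero =>
    rw [Set.ncard_eq_zero] at hn
    exact absurd h.mem_left (hn ▸ Set.notMem_empty x)
  | succ n ih =>
    by_cases hyx : y = x
    · subst hyx
      refine ⟨{y}, fun _ _ => False, by simpa using h.mem_left, rfl, rfl, by simp, by simp,
        .refl rfl, ?_, ?_⟩ <;> rintro z rfl hz <;> exact absurd rfl hz
    obtain ⟨z, hz, h1⟩ := h.cons_cases.resolve_left hyx
    have hc : (T \ {x}).ncard = n := by
      rw [Set.ncard_sdiff_singleton_of_mem h.mem_left, hn]; rfl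
    obtain ⟨P, o, hP, hzP, hyP, ho, hoa, hzy, hf, hg⟩ := ih h1 hc
    have hxP : x ∉ P := fun hx => (hP hx).2 rfl
    refine ⟨insert x P, fun a b => o a b ∨ (a = x ∧ b = z), ?_, .inl rfl, .inr hyP, ?_, ?_, ?_,
      ?_, ?_⟩
    · rintro t (rfl | ht)
      · exact h.mem_left
      · exact (hP ht).1
    · rintro a b (hab | ⟨rfl, rfl⟩)
      · exact ⟨.inr (ho a b hab).1, .inr (ho a b hab).2.1, (ho a b hab).2.2⟩
      · exact ⟨.inl rfl, .inr hzP, hz⟩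
    · rintro a b (hab | ⟨rfl, rfl⟩) (hba | ⟨h1, h2⟩)
      · exact hoa a b hab hba
      · exact hxP (h1 ▸ (ho a b hab).2.1)
      · exact hxP (ho _ _ hba).2.1
      · exact hxP (h1 ▸ hzP)
    · exact .head (.inl rfl) (.inr ⟨rfl, rfl⟩) (hzy.mono (Set.subset_insert _ _) fun _ _ => .inl)
    · intro w hw hwx
      have hwP : w ∈ P := hw.resolve_left hwx
      have hsub : P ⊆ insert x P \ {x} := fun t ht => ⟨.inr ht, fun h => hxP (h ▸ ht)⟩
      by_cases hwz : w = z
      · subst hwz; exact hzy.mono hsub fun _ _ => .inl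
      · exact (hf w hwP hwz).mono (Set.sdiff_subset.trans hsub) fun _ _ => .inl
    · intro w hw hwy
      rcases hw with rfl | hwP
      · exact .refl ⟨.inl rfl, fun h => hyx h.symm⟩
      · refine .head ⟨.inl rfl, fun h => hyx h.symm⟩ (.inr ⟨rfl, rfl⟩)
          ((hg w hwP hwy).mono ?_ fun _ _ => .inl)
        exact fun t ht => ⟨.inr ht.1, ht.2⟩

end ReachIn

/-! ### Directing undirected edges, and reversal -/

namespace MixedGraph

variable {V : Type*}

theorem IsOrientablePath.reflTransGen {G : MixedGraph V} {l : List V} {x y : V}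
    (h : G.IsOrientablePath l x y) : Relation.ReflTransGen G.Step x y := by
  obtain ⟨-, hc, hh, hl⟩ := h
  induction l generalizing x with
  | nil => simp at hh
  | cons a l ih =>
    obtain rfl : a = x := by simpa using hh
    cases l with
    | nil =>
      obtain rfl : a = y := by simpa using hl
      exact .refl
    | cons b l =>
      rw [List.isChain_cons_cons] at hc
      exact .head hc.1 (ih hc.2 rfl (by simpa using hl))

theorem connected_iff [Finite V] (G : MixedGraph V) :
    G.Connected ↔ ∀ x y, Relation.ReflTransGen G.Step x y := by
  constructor
  · intro h x y
    obtain ⟨l, hl⟩ := h x y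
    exact hl.reflTransGen
  · intro h x y
    obtain ⟨l, h1, h2, h3, h4, -⟩ := (ReachIn.of_reflTransGen (h x y)).exists_list
    exact ⟨l, h1, h2, h3, h4⟩

/-- A path inside `T` has at most `T.ncard` vertices, hence one edge fewer. -/
theorem dist_le_of_reachIn [Finite V] {G : MixedGraph V} {T : Set V} {x y : V} {m : ℕ}
    (h : ReachIn G.arc T x y) (hT : T.ncard ≤ m + 1) : G.dist x y ≤ m := by
  classical
  obtain ⟨l, h1, h2, h3, h4, h5⟩ :=
    (h.mono subset_rfl fun a b (hab : G.arc a b) => (Or.inr hab : G.Step a b)).exists_list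
  refine (iInf₂_le l ⟨h1, h2, h3, h4⟩).trans ?_
  have hl : l.length ≤ T.ncard := by
    rw [← List.toFinset_card_of_nodup h1, ← Set.ncard_coe_finset]
    exact Set.ncard_le_ncard fun z hz => h5 z (by simpa using hz)
  exact_mod_cast (by omega : l.length - 1 ≤ m)

theorem orientedDiam_le_of_dist_le {G D : MixedGraph V} {m : ℕ} (hD : D.IsStrongOrientation G)
    (h : ∀ x y, D.dist x y ≤ m) : G.orientedDiam ≤ m :=
  (iInf₂_le D hD).trans (iSup₂_le h)

/-- `G'` arises from `G` by directing some of the undirected edges. -/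
structure Refines (G' G : MixedGraph V) : Prop where
  und_le : ∀ x y, G'.und.Adj x y → G.und.Adj x y
  arc_of_arc : ∀ x y, G.arc x y → G'.arc x y
  of_und : ∀ x y, G.und.Adj x y → G'.und.Adj x y ∨ G'.arc x y ∨ G'.arc y x
  step_of_arc : ∀ x y, G'.arc x y → G.Step x y

theorem Refines.refl (G : MixedGraph V) : G.Refines G :=
  ⟨fun _ _ h => h, fun _ _ h => h, fun _ _ h => .inl h, fun _ _ h => .inr h⟩

theorem Refines.trans {G₁ G₂ G₃ : MixedGraph V} (h : G₁.Refines G₂) (h' : G₂.Refines G₃) :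
    G₁.Refines G₃ where
  und_le x y hxy := h'.und_le x y (h.und_le x y hxy)
  arc_of_arc x y hxy := h.arc_of_arc x y (h'.arc_of_arc x y hxy)
  of_und x y hxy := by
    rcases h'.of_und x y hxy with h1 | h1 | h1
    · exact h.of_und x y h1
    · exact .inr (.inl (h.arc_of_arc _ _ h1))
    · exact .inr (.inr (h.arc_of_arc _ _ h1))
  step_of_arc x y hxy := by
    rcases h.step_of_arc x y hxy with h1 | h1
    · exact .inl (h'.und_le x y h1)
    · exact h'.step_of_arc x y h1

theorem Refines.isOrientation {D G : MixedGraph V} (h : D.Refines G) (hD : D.IsDirected) :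
    D.IsOrientation G where
  directed := hD
  arc_of_arc := h.arc_of_arc
  arc_of_und x y hxy := (h.of_und x y hxy).resolve_left (hD x y)
  step_of_arc := h.step_of_arc

/-- Directing edges does not change the underlying graph, so a bridge of `G'` is already a bridge of
`G`; only connectedness has to be checked. -/
theorem Refines.bridgeless {G' G : MixedGraph V} (h : G'.Refines G) (hG : G.Bridgeless)
    (hc : G'.Connected) : G'.Bridgeless := by
  refine ⟨hc, fun e he => hG.2 e ⟨?_, fun hcon => he.2 (hcon.mono ?_)⟩⟩
  · have := he.1
    induction e with
    | _ a b => exact h.und_le a b this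
  · rintro a b (h1 | h1 | h1)
    · have h1' := (SimpleGraph.deleteEdges_adj.1 h1)
      rcases h.of_und a b h1'.1 with h2 | h2 | h2
      · exact .inl (SimpleGraph.deleteEdges_adj.2 ⟨h2, h1'.2⟩)
      · exact .inr (.inl h2)
      · exact .inr (.inr h2)
    · exact .inr (.inl (h.arc_of_arc a b h1))
    · exact .inr (.inr (h.arc_of_arc b a h1))

/-- The mixed graph obtained from `G` by giving undirected edges the directions prescribed
by `o`. -/
def orientBy (G : MixedGraph V) (o : V → V → Prop) (ho : ∀ x y, o x y → G.und.Adj x y)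
    (ha : ∀ x y, o x y → ¬ o y x) : MixedGraph V where
  und :=
    { Adj := fun x y => G.und.Adj x y ∧ ¬ o x y ∧ ¬ o y x
      symm := ⟨fun _ _ h => ⟨h.1.symm, h.2.2, h.2.1⟩⟩
      loopless := ⟨fun x h => G.und.loopless.irrefl x h.1⟩ }
  arc x y := G.arc x y ∨ o x y
  arc_asymm := by
    rintro x y (h | h) (h' | h')
    · exact G.arc_asymm x y h h'
    · exact G.arc_not_und x y h (ho y x h').symm
    · exact G.arc_not_und y x h' (ho x y h).symm
    · exact ha x y h h'
  arc_not_und := by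
    rintro x y (h | h) h'
    · exact G.arc_not_und x y h h'.1
    · exact h'.2.1 h

theorem orientBy_refines (G : MixedGraph V) (o : V → V → Prop)
    (ho : ∀ x y, o x y → G.und.Adj x y) (ha : ∀ x y, o x y → ¬ o y x) :
    (G.orientBy o ho ha).Refines G where
  und_le _ _ h := h.1
  arc_of_arc _ _ h := .inl h
  of_und x y h := by
    by_cases h1 : o x y
    · exact .inr (.inl (.inr h1))
    by_cases h2 : o y x
    · exact .inr (.inr (.inr h2))
    · exact .inl ⟨h, h1, h2⟩
  step_of_arc x y h := h.elim .inr fun h => .inl (ho x y h)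

/-- Directing an undirected edge `xy` from `x` to `y` keeps the graph connected if one can return
from `y` to `x` without that edge. -/
theorem connected_orientBy_edge [Finite V] {G : MixedGraph V} (hG : G.Connected) {x y : V}
    (hxy : G.und.Adj x y) (h : Relation.ReflTransGen (G.deleteUndEdge s(x, y)).Step y x)
    (ho : ∀ a b, (a = x ∧ b = y) → G.und.Adj a b)
    (ha : ∀ a b, (a = x ∧ b = y) → ¬ (b = x ∧ a = y)) :
    (G.orientBy (fun a b => a = x ∧ b = y) ho ha).Connected := by
  rw [connected_iff] at hG ⊢
  have key : ∀ a b, (G.deleteUndEdge s(x, y)).Step a b →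
      (G.orientBy (fun a b => a = x ∧ b = y) ho ha).Step a b := by
    rintro a b (h1 | h1)
    · obtain ⟨h2, h3⟩ := SimpleGraph.deleteEdges_adj.1 h1
      refine .inl ⟨h2, ?_, ?_⟩
      · rintro ⟨rfl, rfl⟩
        exact h3 rfl
      · rintro ⟨rfl, rfl⟩
        exact h3 Sym2.eq_swap
    · exact .inr (.inl h1)
  intro a b
  have := hG a b
  induction this with
  | refl => exact .refl
  | @tail b c _ hbc ih =>
    refine ih.trans ?_
    by_cases h1 : b = x ∧ c = y
    · exact .single (.inr (.inr h1))
    by_cases h2 : c = x ∧ b = y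
    · obtain ⟨rfl, rfl⟩ := h2
      exact h.lift id key
    rcases hbc with hbc | hbc
    · exact .single (.inl ⟨hbc, h1, h2⟩)
    · exact .single (.inr (.inl hbc))

/-- An undirected edge of a connected mixed graph that is not a bridge can be bypassed in one of its
two directions. -/
theorem Bridgeless.bypass [Finite V] {G : MixedGraph V} (hG : G.Bridgeless) {x y : V}
    (hxy : G.und.Adj x y) :
    Relation.ReflTransGen (G.deleteUndEdge s(x, y)).Step x y ∨
      Relation.ReflTransGen (G.deleteUndEdge s(x, y)).Step y x := by
  by_contra! hcon
  obtain ⟨h1, h2⟩ := hcon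
  set R := Relation.ReflTransGen (G.deleteUndEdge s(x, y)).Step with hR
  have hG' := (connected_iff G).1 hG.1
  have hstep : ∀ a b, G.Step a b → (G.deleteUndEdge s(x, y)).Step a b ∨ a = x ∧ b = y ∨
      a = y ∧ b = x := by
    rintro a b (h | h)
    · by_cases he : s(a, b) = s(x, y)
      · exact .inr (by simpa [Sym2.eq_iff] using he)
      · exact .inl (.inl (SimpleGraph.deleteEdges_adj.2 ⟨h, he⟩))
    · exact .inl (.inr h)
  have hfrom : ∀ w, R x w ∨ R y w := by
    intro w
    have := hG' x w
    induction this with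
    | refl => exact .inl .refl
    | tail _ h ih =>
      rcases hstep _ _ h with h | ⟨rfl, rfl⟩ | ⟨rfl, rfl⟩
      · exact ih.imp (·.tail h) (·.tail h)
      · exact .inr .refl
      · exact .inl .refl
  have hto : ∀ w, R w x ∨ R w y := by
    intro w
    have := hG' w x
    induction this using Relation.ReflTransGen.head_induction_on with
    | refl => exact .inl .refl
    | head h _ ih =>
      rcases hstep _ _ h with h | ⟨rfl, rfl⟩ | ⟨rfl, rfl⟩
      · exact ih.imp (·.head h) (·.head h)
      · exact .inl .refl
      · exact .inr .refl
  -- With no bypass in either direction, the vertices reachable from `x` without the edge are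
  -- exactly those that reach `x`. This set is closed under adjacency in the underlying graph, so it
  -- would contain `y`.
  have hx : ∀ w, R x w → R w x := fun w h => (hto w).resolve_right fun h' => h1 (h.trans h')
  have hx' : ∀ w, R w x → R x w := fun w h => (hfrom w).resolve_right fun h' => h2 (h'.trans h)
  have hcon : (G.deleteUndEdge s(x, y)).underlying.Connected := by
    by_contra hc
    exact hG.2 s(x, y) ⟨hxy, hc⟩
  obtain ⟨p⟩ := hcon.preconnected x y
  have hclosed : ∀ a b, (G.deleteUndEdge s(x, y)).underlying.Adj a b → R x a → R x b := by
    rintro a b (h | h | h) ha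
    · exact ha.tail (.inl h)
    · exact ha.tail (.inr h)
    · exact hx' b (.head (.inr h) (hx a ha))
  have : ∀ {a b} (p : (G.deleteUndEdge s(x, y)).underlying.Walk a b), R x a → R x b := by
    intro a b p
    induction p with
    | nil => exact id
    | cons h _ ih => exact fun ha => ih (hclosed _ _ h ha)
  exact h1 (this p .refl)

/-- In a bridgeless mixed graph a given undirected edge can be directed so that the graph remains
bridgeless. -/
theorem Bridgeless.exists_orient_edge [Finite V] {G : MixedGraph V} (hG : G.Bridgeless) {x y : V}
    (hxy : G.und.Adj x y) : ∃ G' : MixedGraph V, G'.Refines G ∧ G'.Bridgeless ∧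
      ∀ a b, G'.und.Adj a b ↔ G.und.Adj a b ∧ s(a, b) ≠ s(x, y) := by
  have main : ∀ {x y : V}, G.und.Adj x y →
      Relation.ReflTransGen (G.deleteUndEdge s(x, y)).Step y x →
      ∃ G' : MixedGraph V, G'.Refines G ∧ G'.Bridgeless ∧
      ∀ a b, G'.und.Adj a b ↔ G.und.Adj a b ∧ s(a, b) ≠ s(x, y) := by
    intro x y hxy h
    have ho : ∀ a b, (a = x ∧ b = y) → G.und.Adj a b := by
      rintro a b ⟨rfl, rfl⟩
      exact hxy
    have ha : ∀ a b, (a = x ∧ b = y) → ¬ (b = x ∧ a = y) := by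
      rintro a b ⟨rfl, rfl⟩ ⟨rfl, -⟩
      exact G.und.loopless.irrefl _ hxy
    refine ⟨G.orientBy _ ho ha, G.orientBy_refines _ ho ha,
      (G.orientBy_refines _ ho ha).bridgeless hG (connected_orientBy_edge hG.1 hxy h ho ha), ?_⟩
    intro a b
    simp only [orientBy, ne_eq, Sym2.eq_iff]
    tauto
  rcases hG.bypass hxy with h | h
  · rw [Sym2.eq_swap] at h ⊢
    exact main hxy.symm h
  · exact main hxy h

/-- In a bridgeless mixed graph the undirected edges in a given set can be directed so that the
graph remains bridgeless. -/
theorem Bridgeless.exists_orient_set [Finite V] {G : MixedGraph V} (hG : G.Bridgeless)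
    (K : Set (Sym2 V)) : ∃ G' : MixedGraph V, G'.Refines G ∧ G'.Bridgeless ∧
      ∀ a b, G'.und.Adj a b ↔ G.und.Adj a b ∧ s(a, b) ∉ K := by
  induction hn : (G.und.edgeSet ∩ K).ncard generalizing G with
  | zero =>
    rw [Set.ncard_eq_zero] at hn
    refine ⟨G, .refl G, hG, fun a b => ⟨fun h => ⟨h, fun hK => ?_⟩, fun h => h.1⟩⟩
    have : s(a, b) ∈ G.und.edgeSet ∩ K := ⟨h, hK⟩
    rw [hn] at this
    exact this
  | succ n ih =>
    obtain ⟨e, he, heK⟩ : (G.und.edgeSet ∩ K).Nonempty := by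
      rw [Set.nonempty_iff_ne_empty]
      rintro h
      simp [h] at hn
    induction e with
    | _ x y =>
      obtain ⟨G₁, hr, hb, hadj⟩ := hG.exists_orient_edge he
      have hset : G₁.und.edgeSet ∩ K = (G.und.edgeSet ∩ K) \ {s(x, y)} := by
        ext e
        induction e with
        | _ a b =>
          have := hadj a b
          simp only [Set.mem_inter_iff, SimpleGraph.mem_edgeSet, Set.mem_sdiff,
            Set.mem_singleton_iff]
          tauto
      have hmem : s(x, y) ∈ G.und.edgeSet ∩ K := ⟨he, heK⟩
      obtain ⟨G₂, hr₂, hb₂, hadj₂⟩ := ih hb (by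
        rw [hset, Set.ncard_sdiff_singleton_of_mem hmem, hn]; rfl)
      refine ⟨G₂, hr₂.trans hr, hb₂, fun a b => ?_⟩
      rw [hadj₂, hadj]
      constructor
      · exact fun h => ⟨h.1.1, h.2⟩
      · exact fun h => ⟨⟨h.1, fun h' => h.2 (h' ▸ heK)⟩, h.2⟩

/-- The mixed graph in which all directed edges are reversed. -/
def reverse (G : MixedGraph V) : MixedGraph V where
  und := G.und
  arc x y := G.arc y x
  arc_asymm x y h := G.arc_asymm y x h
  arc_not_und x y h h' := G.arc_not_und y x h h'.symm

theorem IsOrientablePath.reverse {G : MixedGraph V} {l : List V} {x y : V}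
    (h : G.IsOrientablePath l x y) : G.reverse.IsOrientablePath l.reverse y x where
  nodup := List.nodup_reverse.2 h.nodup
  chain := by
    rw [List.isChain_reverse]
    refine h.chain.imp fun a b hab => ?_
    exact hab.imp SimpleGraph.Adj.symm id
  head := by rw [List.head?_reverse, h.last]
  last := by rw [List.getLast?_reverse, h.head]

theorem Connected.reverse {G : MixedGraph V} (h : G.Connected) : G.reverse.Connected := by
  intro x y
  obtain ⟨l, hl⟩ := h y x
  exact ⟨_, hl.reverse⟩

theorem Bridgeless.reverse {G : MixedGraph V} (h : G.Bridgeless) : G.reverse.Bridgeless := by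
  refine ⟨h.1.reverse, fun e he => h.2 e ⟨he.1, fun hc => he.2 (hc.mono ?_)⟩⟩
  rintro a b (h1 | h1 | h1)
  · exact .inl h1
  · exact .inr (.inr h1)
  · exact .inr (.inl h1)

theorem dist_reverse_le (G : MixedGraph V) (x y : V) : G.reverse.dist x y ≤ G.dist y x := by
  refine le_iInf₂ fun l hl => ?_
  refine (iInf₂_le l.reverse hl.reverse).trans ?_
  rw [List.length_reverse]

theorem diam_reverse_le (G : MixedGraph V) : G.reverse.diam ≤ G.diam :=
  iSup₂_le fun x y => (G.dist_reverse_le x y).trans (le_iSup₂ (f := fun x y => G.dist x y) y x)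

/-- Reversing every arc turns strong orientations of `G.reverse` into strong orientations of `G` of
no larger diameter. This exchanges in-degree and out-degree. -/
theorem orientedDiam_le_reverse (G : MixedGraph V) : G.orientedDiam ≤ G.reverse.orientedDiam := by
  refine le_iInf₂ fun D hD => ?_
  refine (iInf₂_le D.reverse ⟨⟨hD.1.directed, ?_, ?_, ?_⟩, hD.2.reverse⟩).trans D.diam_reverse_le
  · exact fun x y h => hD.1.arc_of_arc y x h
  · exact fun x y h => (hD.1.arc_of_und x y h).symm
  · exact fun x y h => (hD.1.step_of_arc y x h).imp SimpleGraph.Adj.symm id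

end MixedGraph

/-! ### Choosing the out-neighbours of the hub -/

section Star

variable {V : Type*}

/-- The vertices other than the hub `u` and the rim `N`. -/
def offStar (u : V) (N : Set V) : Set V := {w | w ≠ u ∧ w ∉ N}

/-- An `r`-walk from `x` to `y` whose vertices other than `x` and `y` are neither the hub nor on
the rim. -/
def Link (r : V → V → Prop) (u : V) (N : Set V) (x y : V) : Prop :=
  ReachIn r (insert x (insert y (offStar u N))) x y

/-- The vertices which are off the rim or on the list `F`. -/
def around (N : Set V) (F : List V) : Set V := {t | t ∈ N → t ∈ F}

/-- The relation `r` together with arcs from the hub to `A` and from the rest of the rim to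
the hub. -/
def starRel (r : V → V → Prop) (u : V) (N A : Set V) (x y : V) : Prop :=
  r x y ∨ (x = u ∧ y ∈ A) ∨ (y = u ∧ x ∈ N ∧ x ∉ A)

/-- The properties of a strongly connected relation `r` with additional undirected edges between
the hub and the rim, none of which is a bridge. -/
structure IsStarSystem (r : V → V → Prop) (u : V) (N : Set V) : Prop where
  hub_notMem : u ∉ N
  out_mem : ∀ p, r u p → p ∈ offStar u N
  in_mem : ∀ q, r q u → q ∈ offStar u N
  exists_link : ∀ v ∈ N, ∃ w ∈ insert u N, w ≠ v ∧ (Link r u N v w ∨ Link r u N w v)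
  to_link : ∀ x ∈ offStar u N, ∃ c ∈ insert u N, Link r u N x c
  from_link : ∀ y ∈ offStar u N, ∃ c ∈ insert u N, Link r u N c y

/-- A set `A` of rim vertices, to which the hub shall be directed, that gives short walks. -/
structure IsOutSet (r : V → V → Prop) (u : V) (N A : Set V) : Prop where
  subset : A ⊆ N
  dominates : ∀ b ∈ N, b ∉ A → ∃ c, (c ∈ A ∨ (c ∈ N ∧ Link r u N u c) ∨ c = u) ∧ c ≠ b ∧
    Link r u N c b
  not_link : ∀ a ∈ A, ¬ Link r u N u a
  leaves : ∀ a ∈ A, (∃ b ∈ N, b ∉ A ∧ Link r u N a b ∧ ¬ Link r u N u b) ∨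
    ∃ w ∈ insert u N, w ≠ a ∧ Link r u N a w ∧
      (w ∈ A → ∃ b ∈ N, b ∉ A ∧ Link r u N w b ∧ ¬ Link r u N u b)

variable {r : V → V → Prop} {u : V} {N : Set V}

theorem Link.refl (x : V) : Link r u N x x := ReachIn.refl (Set.mem_insert _ _)

theorem Link.flip {x y : V} (h : Link r u N x y) : Link (fun a b => r b a) u N y x := by
  unfold Link at h ⊢
  rw [Set.insert_comm]
  exact ReachIn.flip h

/-- Take `A` minimal subject to domination of the rest of the rim and to every member having an
outgoing link. As no `a ∈ A` can be dropped, either some `b ∉ A` is dominated by `a` alone, or `a`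
itself is dominated by nothing else. -/
theorem IsStarSystem.exists_isOutSet [Finite V] (h : IsStarSystem r u N) :
    ∃ A, IsOutSet r u N A := by
  let C : Set V → Prop := fun A => A ⊆ N ∧ (∀ a ∈ A, ∃ w ∈ insert u N, w ≠ a ∧ Link r u N a w) ∧
    ∀ b ∈ N, b ∉ A → ∃ c, (c ∈ A ∨ (c ∈ N ∧ Link r u N u c) ∨ c = u) ∧ c ≠ b ∧ Link r u N c b
  -- All rim vertices with an outgoing link qualify: any other rim vertex has an incoming link,
  -- whose source is the hub or, by that very link, a member of the set.
  have h0 : C {a | a ∈ N ∧ ∃ w ∈ insert u N, w ≠ a ∧ Link r u N a w} := by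
    refine ⟨fun a ha => ha.1, fun a ha => ha.2, fun b hb hbA => ?_⟩
    obtain ⟨w, hw, hwb, hl | hl⟩ := h.exists_link b hb
    · exact absurd ⟨hb, w, hw, hwb, hl⟩ hbA
    · rcases hw with rfl | hw
      · exact ⟨w, .inr (.inr rfl), hwb, hl⟩
      · exact ⟨w, .inl ⟨hw, b, .inr hb, hwb.symm, hl⟩, hwb, hl⟩
  obtain ⟨A, hA⟩ := (Set.toFinite {A | C A}).exists_minimal ⟨_, h0⟩
  obtain ⟨hAN, hout, hdom⟩ : C A := hA.1
  have key : ∀ a ∈ A, ¬ Link r u N u a ∧ ((∃ b ∈ N, b ∉ A ∧ Link r u N a b ∧ ¬ Link r u N u b) ∨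
      ∀ c ∈ A, c ≠ a → ¬ Link r u N c a) := by
    intro a ha
    have hua : u ≠ a := fun hh => h.hub_notMem (hh ▸ hAN ha)
    -- Outgoing links are inherited by `A \ {a}`, so it is domination that fails, at some `b`:
    -- either `b = a`, or `a` was the only dominator of `b`.
    have hnot : ¬ C (A \ {a}) := fun hC => (hA.2 hC Set.sdiff_subset ha).2 rfl
    have hex : ∃ b ∈ N, b ∉ A \ {a} ∧ ∀ c, (c ∈ A \ {a} ∨ (c ∈ N ∧ Link r u N u c) ∨ c = u) →
        c ≠ b → ¬ Link r u N c b := by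
      by_contra! hcon
      exact hnot ⟨Set.sdiff_subset.trans hAN, fun x hx => hout x hx.1, fun b hb hbA => hcon b hb hbA⟩
    obtain ⟨b, hb, hbA, hbc⟩ := hex
    by_cases hba : b = a
    · subst hba
      refine ⟨hbc u (.inr (.inr rfl)) hua, .inr fun c hc hcb => hbc c (.inl ⟨hc, hcb⟩) hcb⟩
    · have hbA' : b ∉ A := fun hh => hbA ⟨hh, hba⟩
      have hub : u ≠ b := fun hh => h.hub_notMem (hh ▸ hb)
      obtain ⟨c, hc, hcb, hl⟩ := hdom b hb hbA'
      have hca : c = a := by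
        by_contra hca
        refine hbc c ?_ hcb hl
        rcases hc with hc | hc
        · exact .inl ⟨hc, hca⟩
        · exact .inr hc
      subst hca
      refine ⟨fun hu => hbc c (.inr (.inl ⟨hAN ha, hu⟩)) hcb hl,
        .inl ⟨b, hb, hbA', hl, hbc u (.inr (.inr rfl)) hub⟩⟩
  refine ⟨A, hAN, hdom, fun a ha => (key a ha).1, fun a ha => ?_⟩
  rcases (key a ha).2 with h1 | h1
  · exact .inl h1
  -- If `w ∈ A`, the link from `a` dominates `w`, so `w` must be needed for some private `b`.
  · obtain ⟨w, hw, hwa, hl⟩ := hout a ha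
    exact .inr ⟨w, hw, hwa, hl, fun hwA =>
      (key w hwA).2.resolve_right fun hh => hh a ha hwa.symm hl⟩

theorem Link.mono_around {x y : V} (h : Link r u N x y) {A : Set V} {F : List V} (hx : x ∈ N → x ∈ F)
    (hy : y ∈ N → y ∈ F) : ReachIn (starRel r u N A) (around N F) x y := by
  refine h.mono ?_ fun _ _ => .inl
  rintro t (rfl | rfl | ht)
  · exact hx
  · exact hy
  · exact fun htN => absurd htN ht.2

/-- A link whose end cannot be reached directly from the hub avoids the out-neighbours of the
hub. -/
theorem Link.avoid_out (hs : IsStarSystem r u N) {x y : V} (h : Link r u N x y)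
    (hy : ¬ Link r u N u y) :
    ReachIn r (insert x (insert y (offStar u N)) \ {p | r u p}) x y := by
  have hup : ∀ {p}, r u p → ReachIn r (insert y (offStar u N)) p y → Link r u N u y :=
    fun hp h => .head (.inl rfl) hp (h.mono_set (Set.subset_insert _ _))
  by_cases hx : r u x
  · refine absurd (hup hx (h.mono_set ?_)) hy
    exact Set.insert_subset (.inr (hs.out_mem x hx)) subset_rfl
  · refine (ReachIn.avoid_last h {p | r u p} hx).resolve_right ?_
    rintro ⟨p, hp, h1⟩
    exact hy (hup hp (h1.mono_set fun t ht => ht.1.resolve_left ht.2))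

/-- A link, possibly within a smaller set, whose end is on the rim avoids a given in-neighbour of the hub, or the hub can be reached
directly. -/
theorem IsStarSystem.avoid_in (hs : IsStarSystem r u N) {x y q : V} {Z : Set V}
    (h : ReachIn r (insert x (insert y (offStar u N)) \ Z) x y) (hy : y ∈ N) (hq : r q u) :
    ReachIn r ((insert x (insert y (offStar u N)) \ Z) \ {q}) x y ∨ Link r u N x u := by
  refine (ReachIn.avoid_first h {q} ?_).imp_right ?_
  · rintro rfl
    exact (hs.in_mem _ hq).2 hy
  · rintro ⟨q, rfl, h1⟩
    refine ReachIn.tail (h1.mono_set ?_) (.inr (.inl rfl)) hq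
    rintro t ⟨⟨rfl | rfl | ht, -⟩, ht'⟩
    · exact .inl rfl
    · exact absurd rfl ht'
    · exact .inr (.inr ht)

theorem ncard_le_of_subset_around [Finite V] {T : Set V} {F : List V} (hT : T ⊆ around N F) :
    T.ncard ≤ Nᶜ.ncard + F.length := by
  classical
  have h1 : T ⊆ Nᶜ ∪ (F.toFinset : Set V) := by
    intro t ht
    by_cases htN : t ∈ N
    · exact .inr (by simpa using hT ht htN)
    · exact .inl htN
  refine (Set.ncard_le_ncard h1).trans ((Set.ncard_union_le _ _).trans ?_)
  rw [Set.ncard_coe_finset]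
  exact Nat.add_le_add_left (List.toFinset_card_le F) _

theorem ncard_lt_of_subset_around [Finite V] {T : Set V} {F : List V} (hT : T ⊆ around N F) {z : V}
    (hz : z ∉ N) (hzT : z ∉ T) : T.ncard < Nᶜ.ncard + F.length := by
  classical
  have h1 : T ⊆ (Nᶜ \ {z}) ∪ (F.toFinset : Set V) := by
    intro t ht
    by_cases htN : t ∈ N
    · exact .inr (by simpa using hT ht htN)
    · exact .inl ⟨htN, fun h => hzT (h ▸ ht)⟩
  have h2 : (Nᶜ \ {z}).ncard < Nᶜ.ncard := Set.ncard_sdiff_singleton_lt_of_mem hz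
  refine ((Set.ncard_le_ncard h1).trans (Set.ncard_union_le _ _)).trans_lt ?_
  rw [Set.ncard_coe_finset]
  exact Nat.add_lt_add_of_lt_of_le h2 (List.toFinset_card_le F)

/-- A walk from `x` to `y` with at most `k` vertices. -/
def ReachLE (r : V → V → Prop) (k : ℕ) (x y : V) : Prop :=
  ∃ T, ReachIn r T x y ∧ T.ncard ≤ k

theorem ReachIn.reachLE [Finite V] {s : V → V → Prop} {T : Set V} {x y : V} (h : ReachIn s T x y)
    (F : List V) (hT : T ⊆ around N F) {k : ℕ} (hF : F.length ≤ k) :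
    ReachLE s (Nᶜ.ncard + k) x y :=
  ⟨T, h, (ncard_le_of_subset_around hT).trans (Nat.add_le_add_left hF _)⟩

/-- The missing off-rim vertex `z` pays for one additional rim vertex. -/
theorem ReachIn.reachLE_of_notMem [Finite V] {s : V → V → Prop} {T : Set V} {x y : V}
    (h : ReachIn s T x y) (F : List V) (hT : T ⊆ around N F) {z : V} (hz : z ∉ N) (hzT : z ∉ T)
    {k : ℕ} (hF : F.length ≤ k + 1) : ReachLE s (Nᶜ.ncard + k) x y := by
  have := ncard_lt_of_subset_around hT hz hzT
  exact ⟨T, h, by omega⟩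

theorem around_mono {F F' : List V} (h : F ⊆ F') : around N F ⊆ around N F' :=
  fun _ ht htN => h (ht htN)

/-- How the hub is reached when the set `A ∪ L` is chosen as its set of out-neighbours on the
rim. -/
theorem to_hub_cases (hs : IsStarSystem r u N) {A L : Set V} (hA : IsOutSet r u N A)
    (hL : ∀ l ∈ L, l ∈ N ∧ l ∉ A ∧ Link r u N u l ∧
      ∃ b ∈ N, b ∉ A ∧ ¬ Link r u N u b ∧ Link r u N l b) (x : V) :
    (∃ a b, ReachIn (starRel r u N (A ∪ L)) (around N [a, b]) x u) ∨
    (∃ a ∈ A, ∃ a' ∈ A, ∃ c ∈ N, c ∉ A ∧ ¬ Link r u N u c ∧ (x ∈ N → x = a) ∧ Link r u N x a ∧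
      Link r u N a a' ∧ Link r u N a' c) ∨
    (∃ v ∈ A, ∃ l ∈ L, (x ∈ N → x = v) ∧ Link r u N x v ∧ Link r u N v l) := by
  have hback : ∀ b ∈ N, b ∉ A → b ∉ L → starRel r u N (A ∪ L) b u := fun b hb hbA hbL =>
    .inr (.inr ⟨rfl, hb, fun h => h.elim hbA hbL⟩)
  have hu : ∀ F, u ∈ around N F := fun F h => absurd h hs.hub_notMem
  have hLl : ∀ b, ¬ Link r u N u b → b ∉ L := fun b hb hbL => hb (hL b hbL).2.2.1
  have step : ∀ {a b}, b ∈ N → b ∉ A → b ∉ L → Link r u N a b →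
      ReachIn (starRel r u N (A ∪ L)) (around N [a, b]) a u := fun hb hbA hbL h =>
    (h.mono_around (by simp) (by simp)).tail (hu _) (hback _ hb hbA hbL)
  -- A vertex outside `A ∪ L` steps straight to the hub, and one in `L` does so after a link to its
  -- `b`, which is not in `L` because the hub does not link to it. For `a ∈ A` the alternatives of
  -- `hA.leaves` decide.
  have main : ∀ a ∈ N, (∃ b, ReachIn (starRel r u N (A ∪ L)) (around N [a, b]) a u) ∨
      (a ∈ A ∧ ∃ a' ∈ A, ∃ c ∈ N, c ∉ A ∧ ¬ Link r u N u c ∧ Link r u N a a' ∧ Link r u N a' c) ∨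
      (a ∈ A ∧ ∃ l ∈ L, Link r u N a l) := by
    intro a ha
    by_cases haA : a ∈ A
    · rcases hA.leaves a haA with ⟨b, hb, hbA, hl, hub⟩ | ⟨w, hw, -, hl, hwA⟩
      · exact .inl ⟨b, step hb hbA (hLl b hub) hl⟩
      · rcases hw with rfl | hw
        · exact .inl ⟨a, hl.mono_around (by simp) fun h => absurd h hs.hub_notMem⟩
        · by_cases hwA' : w ∈ A
          · obtain ⟨b, hb, hbA, hwb, hub⟩ := hwA hwA'
            exact .inr (.inl ⟨haA, w, hwA', b, hb, hbA, hub, hl, hwb⟩)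
          · by_cases hwL : w ∈ L
            · exact .inr (.inr ⟨haA, w, hwL, hl⟩)
            · exact .inl ⟨w, step hw hwA' hwL hl⟩
    · by_cases haL : a ∈ L
      · obtain ⟨-, -, -, b, hb, hbA, hub, hl⟩ := hL a haL
        exact .inl ⟨b, step hb hbA (hLl b hub) hl⟩
      · exact .inl ⟨a, step ha haA haL (.refl a)⟩
  by_cases hxu : x = u
  · subst hxu
    exact .inl ⟨x, x, .refl (hu _)⟩
  by_cases hxN : x ∈ N
  · rcases main x hxN with ⟨b, h⟩ | ⟨h1, a', ha', c, hc, hcA, h2, h3, h4⟩ | ⟨h1, l, hl, h2⟩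
    · exact .inl ⟨x, b, h⟩
    · exact .inr (.inl ⟨x, h1, a', ha', c, hc, hcA, h2, fun _ => rfl, .refl x, h3, h4⟩)
    · exact .inr (.inr ⟨x, h1, l, hl, fun _ => rfl, .refl x, h2⟩)
  · obtain ⟨a, ha, hl⟩ := hs.to_link x ⟨hxu, hxN⟩
    rcases ha with rfl | ha
    · exact .inl ⟨a, a, hl.mono_around (fun h => absurd h hxN) fun h => absurd h hs.hub_notMem⟩
    rcases main a ha with ⟨b, h⟩ | ⟨h1, a', ha', c, hc, hcA, h2, h3, h4⟩ | ⟨h1, l, hl', h2⟩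
    · exact .inl ⟨a, b, (hl.mono_around (fun h => absurd h hxN) (by simp)).trans h⟩
    · exact .inr (.inl ⟨a, h1, a', ha', c, hc, hcA, h2, fun h => absurd h hxN, hl, h3, h4⟩)
    · exact .inr (.inr ⟨a, h1, l, hl', fun h => absurd h hxN, hl, h2⟩)

/-- How a vertex is reached from the hub when the set `A ∪ L` is chosen as its set of
out-neighbours on the rim. -/
theorem from_hub_cases (hs : IsStarSystem r u N) {A : Set V} (L : Set V) (hA : IsOutSet r u N A)
    (hLN : L ⊆ N) (y : V) :
    (∃ c, ReachIn (starRel r u N (A ∪ L)) (around N [c]) u y) ∨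
    (∃ c b, ReachIn (starRel r u N (A ∪ L)) (around N [c, b] \ {p | r u p}) u y) ∨
    (∃ l ∈ N, l ∉ A ∪ L ∧ Link r u N u l ∧ ∃ b ∈ N, b ∉ A ∧ ¬ Link r u N u b ∧ Link r u N l b ∧
      (y ∈ N → y = b) ∧ Link r u N b y) := by
  have hu : ∀ F, u ∈ around N F := fun F h => absurd h hs.hub_notMem
  by_cases huy : Link r u N u y
  · exact .inl ⟨y, huy.mono_around (fun h => absurd h hs.hub_notMem) (by simp)⟩
  have hALN : A ∪ L ⊆ N := Set.union_subset hA.subset hLN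
  have main : ∀ c ∈ N, (y ∈ N → y = c) → Link r u N c y →
    (∃ c, ReachIn (starRel r u N (A ∪ L)) (around N [c]) u y) ∨
    (∃ c b, ReachIn (starRel r u N (A ∪ L)) (around N [c, b] \ {p | r u p}) u y) ∨
    (∃ l ∈ N, l ∉ A ∪ L ∧ Link r u N u l ∧ ∃ b ∈ N, b ∉ A ∧ ¬ Link r u N u b ∧ Link r u N l b ∧
      (y ∈ N → y = b) ∧ Link r u N b y) := by
    intro c hc hyc hl
    by_cases huc : Link r u N u c
    · refine .inl ⟨c, (huc.mono_around (fun h => absurd h hs.hub_notMem) (by simp)).trans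
        (hl.mono_around (by simp) fun h => by simp [hyc h])⟩
    -- Since the hub does not link to `y`, the link into `y` can be taken to miss all out-neighbours
    -- of the hub.
    have hl' : ∀ F, c ∈ F → ReachIn (starRel r u N (A ∪ L)) (around N F \ {p | r u p}) c y := by
      intro F hF
      refine (hl.avoid_out hs huy).mono ?_ fun _ _ => .inl
      rintro t ⟨rfl | rfl | ht, htp⟩
      · exact ⟨fun _ => hF, htp⟩
      · exact ⟨fun h => hyc h ▸ hF, htp⟩
      · exact ⟨fun h => absurd h ht.2, htp⟩
    have huP : ¬ r u u := fun h => (hs.out_mem u h).1 rfl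
    have hNP : ∀ c ∈ N, ¬ r u c := fun c hc h => (hs.out_mem c h).2 hc
    have hstep : ∀ d ∈ A ∪ L, ∀ F, d ∈ F →
        ReachIn (starRel r u N (A ∪ L)) (around N F \ {p | r u p}) u d := fun d hd F hF =>
      .single ⟨hu _, huP⟩ ⟨fun _ => hF, hNP d (hALN hd)⟩ (.inr (.inl ⟨rfl, hd⟩))
    by_cases hcA : c ∈ A ∪ L
    · exact .inr (.inl ⟨c, c, (hstep c hcA _ (by simp)).trans (hl' _ (by simp))⟩)
    have hviaA : ∀ d ∈ A ∪ L, Link r u N d c →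
        ReachIn (starRel r u N (A ∪ L)) (around N [d, c] \ {p | r u p}) u y := by
      intro d hd hdc
      refine ((hstep d hd _ (by simp)).trans ((hdc.avoid_out hs huc).mono ?_ fun _ _ => .inl)).trans
        (hl' _ (by simp))
      rintro t ⟨rfl | rfl | ht, htp⟩
      · exact ⟨fun _ => by simp, htp⟩
      · exact ⟨fun _ => by simp, htp⟩
      · exact ⟨fun h => absurd h ht.2, htp⟩
    -- A dominator in `A ∪ L` is entered by a star arc, which uses no out-neighbour from `r`. Only a
    -- dominator outside `A ∪ L` that is linked from the hub leads to the third alternative.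
    obtain ⟨d, hd, -, hdc⟩ := hA.dominates c hc fun h => hcA (.inl h)
    rcases hd with hd | ⟨hdN, hud⟩ | rfl
    · exact .inr (.inl ⟨d, c, hviaA d (.inl hd) hdc⟩)
    · by_cases hdA : d ∈ A ∪ L
      · exact .inr (.inl ⟨d, c, hviaA d hdA hdc⟩)
      · exact .inr (.inr ⟨d, hdN, hdA, hud, c, hc, fun h => hcA (.inl h), huc, hdc, hyc, hl⟩)
    · exact absurd hdc huc
  by_cases hyu : y = u
  · subst hyu
    exact absurd (.refl y) huy
  by_cases hyN : y ∈ N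
  · exact main y hyN (fun _ => rfl) (.refl y)
  · obtain ⟨c, hc, hl⟩ := hs.from_link y ⟨hyu, hyN⟩
    rcases hc with rfl | hc
    · exact absurd hl huy
    · exact main c hc (fun h => absurd h hyN) hl

end Star

/-! ### Counting rim vertices on walks through the hub -/

section Star

variable {V : Type*} {r : V → V → Prop} {u : V} {N : Set V}

theorem ReachIn.reachLE_trans [Finite V] {s : V → V → Prop} {F F' : List V} {x y z : V}
    (h : ReachIn s (around N F) x y) (h' : ReachIn s (around N F') y z) {k : ℕ}
    (hF : F.length + F'.length ≤ k) : ReachLE s (Nᶜ.ncard + k) x z := by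
  refine ReachIn.reachLE ((h.mono_set (around_mono (List.subset_append_left F F'))).trans
    (h'.mono_set (around_mono (List.subset_append_right F F')))) (F ++ F') subset_rfl ?_
  simpa using hF

theorem ReachIn.reachLE_trans_of_notMem [Finite V] {s : V → V → Prop} {F F' : List V} {x y z : V}
    {Z Z' : Set V} (h : ReachIn s (around N F \ Z) x y) (h' : ReachIn s (around N F' \ Z') y z)
    {w : V} (hw : w ∉ N) (hwZ : w ∈ Z) (hwZ' : w ∈ Z') {k : ℕ}
    (hF : F.length + F'.length ≤ k + 1) : ReachLE s (Nᶜ.ncard + k) x z := by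
  refine ReachIn.reachLE_of_notMem (T := around N (F ++ F') \ {w}) ((h.mono_set ?_).trans (h'.mono_set ?_))
    (F ++ F') Set.sdiff_subset hw (fun h => h.2 rfl) (by simpa using hF)
  · exact fun t ht => ⟨around_mono (List.subset_append_left F F') ht.1, fun h => ht.2 (h ▸ hwZ)⟩
  · exact fun t ht => ⟨around_mono (List.subset_append_right F F') ht.1, fun h => ht.2 (h ▸ hwZ')⟩

/-- The hub is reached by three consecutive links that avoid the out-neighbours of the hub. -/
theorem to_hub_avoid_out (hs : IsStarSystem r u N) {A B : Set V} (hA : IsOutSet r u N A)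
    {x a a' c : V} (ha : a ∈ A) (ha' : a' ∈ A) (hc : c ∈ N) (hcB : c ∉ B)
    (huc : ¬ Link r u N u c) (hxa : x ∈ N → x = a) (h1 : Link r u N x a) (h2 : Link r u N a a')
    (h3 : Link r u N a' c) :
    ReachIn (starRel r u N B) (around N [a, a', c] \ {p | r u p}) x u := by
  have huP : ¬ r u u := fun h => (hs.out_mem u h).1 rfl
  have key : ∀ {x y}, Link r u N x y → ¬ Link r u N u y → (x ∈ N → x ∈ [a, a', c]) →
      y ∈ [a, a', c] → ReachIn (starRel r u N B) (around N [a, a', c] \ {p | r u p}) x y := by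
    intro x y h hy hx hyF
    refine (h.avoid_out hs hy).mono ?_ fun _ _ => .inl
    rintro t ⟨rfl | rfl | ht, htp⟩
    · exact ⟨hx, htp⟩
    · exact ⟨fun _ => hyF, htp⟩
    · exact ⟨fun h => absurd h ht.2, htp⟩
  refine ReachIn.tail ((key h1 (hA.not_link a ha) (fun h => by simp [hxa h]) (by simp)).trans
    ((key h2 (hA.not_link a' ha') (by simp) (by simp)).trans
    (key h3 huc (by simp) (by simp)))) ?_ (.inr (.inr ⟨rfl, hc, hcB⟩))
  exact ⟨fun h => absurd h hs.hub_notMem, huP⟩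

theorem from_hub_link_link {B : Set V} (hs : IsStarSystem r u N) {l b y : V} (h1 : Link r u N u l)
    (h2 : Link r u N l b) (h3 : Link r u N b y) (hyb : y ∈ N → y = b) :
    ReachIn (starRel r u N B) (around N [l, b]) u y :=
  ((h1.mono_around (fun h => absurd h hs.hub_notMem) (by simp)).trans
    (h2.mono_around (by simp) (by simp))).trans
    (h3.mono_around (by simp) fun h => by simp [hyb h])

/-- A vertex is reached from the hub with at most two vertices on the rim. -/
theorem from_hub (hs : IsStarSystem r u N) {A : Set V} (L : Set V) (hA : IsOutSet r u N A)
    (hLN : L ⊆ N) (y : V) :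
    ∃ c b, ReachIn (starRel r u N (A ∪ L)) (around N [c, b]) u y := by
  rcases from_hub_cases hs L hA hLN y with ⟨c, h⟩ | ⟨c, b, h⟩ |
    ⟨l, -, -, h1, b, -, -, -, h2, hyb, h3⟩
  · exact ⟨c, c, h.mono_set (around_mono (by simp))⟩
  · exact ⟨c, b, h.mono_set Set.sdiff_subset⟩
  · exact ⟨l, b, from_hub_link_link hs h1 h2 h3 hyb⟩

/-- Three rim vertices suffice to reach the hub and two to leave it. -/
theorem exists_starRel_le_add_five [Finite V] (hs : IsStarSystem r u N) :
    ∃ A ⊆ N, ∀ x y, ReachLE (starRel r u N A) (Nᶜ.ncard + 5) x y := by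
  obtain ⟨A, hA⟩ := hs.exists_isOutSet
  refine ⟨A ∪ ∅, by simpa using hA.subset, fun x y => ?_⟩
  obtain ⟨c, b, hg⟩ := from_hub hs ∅ hA (Set.empty_subset _) y
  rcases to_hub_cases hs (L := ∅) hA (by simp) x with ⟨a, a', hf⟩ |
    ⟨a, ha, a', ha', d, hd, hdA, hud, hxa, h1, h2, h3⟩ | ⟨_, _, _, h, _⟩
  · exact hf.reachLE_trans hg (by simp)
  · exact ((to_hub_avoid_out hs hA ha ha' hd (by simpa using hdA) hud hxa h1 h2 h3).mono_set
      Set.sdiff_subset).reachLE_trans hg (by simp)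
  · exact absurd h (Set.notMem_empty _)

/-- Only a walk with three rim vertices before the hub and two after it is too long. Its first half
misses both `p` and `q`, and its second half can be shortened to miss one of them. -/
theorem exists_starRel_of_two_out [Finite V] (hs : IsStarSystem r u N) {p q : V} (hpq : p ≠ q)
    (hp : r u p) (hq : r u q) :
    ∃ A ⊆ N, ∀ x y, ReachLE (starRel r u N A) (Nᶜ.ncard + 4) x y := by
  obtain ⟨A, hA⟩ := hs.exists_isOutSet
  refine ⟨A ∪ ∅, by simpa using hA.subset, fun x y => ?_⟩
  have hpN := (hs.out_mem p hp)
  have hqN := (hs.out_mem q hq)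
  rcases to_hub_cases hs (L := ∅) hA (by simp) x with ⟨a, a', hf⟩ |
    ⟨a, ha, a', ha', d, hd, hdA, hud, hxa, h1, h2, h3⟩ | ⟨_, _, _, h, _⟩
  · obtain ⟨c, b, hg⟩ := from_hub hs ∅ hA (Set.empty_subset _) y
    exact hf.reachLE_trans hg (by simp)
  · have hf := to_hub_avoid_out (B := A ∪ ∅) hs hA ha ha' hd (by simpa using hdA) hud hxa h1 h2 h3
    rcases from_hub_cases hs ∅ hA (Set.empty_subset _) y with ⟨c, h⟩ | ⟨c, b, h⟩ |
      ⟨l, -, -, h1, b, -, -, -, h2, hyb, h3⟩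
    · exact (hf.mono_set Set.sdiff_subset).reachLE_trans h (by simp)
    · exact hf.reachLE_trans_of_notMem h hpN.2 hp hp (by simp)
    · have hg : ReachIn (starRel r u N (A ∪ ∅)) (around N [l, b]) u y :=
        from_hub_link_link hs h1 h2 h3 hyb
      have huT : u ∈ around N [l, b] := hg.mem_left
      -- If `p` or `q` is visited, step from the hub directly to the one visited last; the other is
      -- then missed.
      rcases hg.avoid_or_last {p, q} with h | ⟨z, rfl | rfl, h⟩
      · exact hf.reachLE_trans_of_notMem h hpN.2 hp (.inl rfl) (by simp)
      · refine hf.reachLE_trans_of_notMem (Z' := {q}) (.head ⟨huT, hqN.1.symm⟩ (.inl hp)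
          (h.mono_set ?_)) hqN.2 hq rfl (by simp)
        rintro t (rfl | ht)
        · exact ⟨fun h => absurd h hpN.2, hpq⟩
        · exact ⟨ht.1, fun h => ht.2 (.inr h)⟩
      · refine hf.reachLE_trans_of_notMem (Z' := {p}) (.head ⟨huT, hpN.1.symm⟩ (.inl hq)
          (h.mono_set ?_)) hpN.2 hp rfl (by simp)
        rintro t (rfl | ht)
        · exact ⟨fun h => absurd h hqN.2, hpq.symm⟩
        · exact ⟨ht.1, fun h => ht.2 (.inl h)⟩
  · exact absurd h (Set.notMem_empty _)

/-- The hub is also directed to the vertices of `L`, which have no link from `A`. In the critical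
case five rim vertices `a, a', d, l, b` occur with `l ∉ L`, so some `v ∈ A` links to `l`. If the
five are distinct they are the whole rim, and `v` is `a` or `a'`; then the walk can bypass `d` and
the hub. -/
theorem exists_starRel_of_out_of_ncard_eq [Finite V] (hs : IsStarSystem r u N) {p : V}
    (hp : r u p) (hN : N.ncard = 5) :
    ∃ A ⊆ N, ∀ x y, ReachLE (starRel r u N A) (Nᶜ.ncard + 4) x y := by
  classical
  obtain ⟨A, hA⟩ := hs.exists_isOutSet
  set L : Set V := {l | l ∈ N ∧ l ∉ A ∧ Link r u N u l ∧
    (∃ b ∈ N, b ∉ A ∧ ¬ Link r u N u b ∧ Link r u N l b) ∧ ∀ v ∈ A, ¬ Link r u N v l}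
  have hLN : L ⊆ N := fun l hl => hl.1
  refine ⟨A ∪ L, Set.union_subset hA.subset hLN, fun x y => ?_⟩
  have hpN := (hs.out_mem p hp)
  rcases to_hub_cases hs (L := L) hA (fun l hl => ⟨hl.1, hl.2.1, hl.2.2.1, hl.2.2.2.1⟩) x with
    ⟨a, a', hf⟩ | ⟨a, ha, a', ha', d, hd, hdA, hud, hxa, h1, h2, h3⟩ | ⟨v, hv, l, hl, -, -, h⟩
  · obtain ⟨c, b, hg⟩ := from_hub hs L hA hLN y
    exact hf.reachLE_trans hg (by simp)
  · have hdL : d ∉ L := fun h => hud h.2.2.1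
    have hf := to_hub_avoid_out (B := A ∪ L) hs hA ha ha' hd (fun h => h.elim hdA hdL) hud hxa
      h1 h2 h3
    rcases from_hub_cases hs L hA hLN y with ⟨c, h⟩ | ⟨c, b, h⟩ |
      ⟨l, hlN, hlA, hul, b, hb, hbA, hub, hlb, hyb, hby⟩
    · exact (hf.mono_set Set.sdiff_subset).reachLE_trans h (by simp)
    · exact hf.reachLE_trans_of_notMem h hpN.2 hp hp (by simp)
    have hsub : ∀ v ∈ A, Link r u N v l → v = a ∨ v = a' ∨
        ({a, a', d, l, b} : Finset V).card ≤ 4 := by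
      intro v hv _
      by_contra! hcon
      obtain ⟨hva, hva', hcard⟩ := hcon
      have h5 : ({a, a', d, l, b} : Finset V).card = 5 := by
        have := Finset.card_le_five (a := a) (b := a') (c := d) (d := l) (e := b)
        omega
      have hsubset : (({a, a', d, l, b} : Finset V) : Set V) ⊆ N := by
        intro t ht
        simp only [Finset.coe_insert, Finset.coe_singleton, Set.mem_insert_iff,
          Set.mem_singleton_iff] at ht
        rcases ht with rfl | rfl | rfl | rfl | rfl
        exacts [hA.subset ha, hA.subset ha', hd, hlN, hb]
      have heq := Set.eq_of_subset_of_ncard_le hsubset (by rw [Set.ncard_coe_finset, h5, hN])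
      have hvN : v ∈ (({a, a', d, l, b} : Finset V) : Set V) := heq ▸ hA.subset hv
      simp only [Finset.coe_insert, Finset.coe_singleton, Set.mem_insert_iff,
        Set.mem_singleton_iff] at hvN
      rcases hvN with h | h | rfl | rfl | rfl
      exacts [hva h, hva' h, hdA hv, hlA (.inl hv), hbA hv]
    -- A coincidence among the five already brings the count down to four.
    have hsmall : ({a, a', d, l, b} : Finset V).card ≤ 4 →
        ReachLE (starRel r u N (A ∪ L)) (Nᶜ.ncard + 4) x y := by
      intro h4
      refine ReachIn.reachLE (N := N) (T := around N ({a, a', d, l, b} : Finset V).toList)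
        (((hf.mono_set Set.sdiff_subset).mono_set ?_).trans
        ((from_hub_link_link hs hul hlb hby hyb).mono_set ?_)) _ subset_rfl (by simpa using h4)
      · exact around_mono fun t => by simp; tauto
      · exact around_mono fun t => by simp; tauto
    obtain ⟨v, hv, hvl⟩ : ∃ v ∈ A, Link r u N v l := by
      by_contra! hcon
      exact hlA (.inr ⟨hlN, fun h => hlA (.inl h), hul, ⟨b, hb, hbA, hub, hlb⟩, hcon⟩)
    have hmono : ∀ {x y}, Link r u N x y → (x ∈ N → x ∈ [a, a', l, b]) →
      (y ∈ N → y ∈ [a, a', l, b]) → ReachIn (starRel r u N (A ∪ L)) (around N [a, a', l, b]) x y :=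
      fun h hx hy => h.mono_around hx hy
    have hxa' := hmono h1 (fun h => by simp [hxa h]) (by simp)
    have hly := (hmono hlb (by simp) (by simp)).trans (hmono hby (by simp) fun h => by simp [hyb h])
    rcases hsub v hv hvl with rfl | rfl | h4
    · exact ReachIn.reachLE ((hxa'.trans (hmono hvl (by simp) (by simp))).trans hly) _ subset_rfl
        (by simp)
    · exact ReachIn.reachLE (((hxa'.trans (hmono h2 (by simp) (by simp))).trans
        (hmono hvl (by simp) (by simp))).trans hly) _ subset_rfl (by simp)
    · exact hsmall h4
  · exact absurd h (hl.2.2.2.2 v hv)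

/-- The off-rim vertex to be saved is `p`, `q` or the hub itself. Membership of `l` in `L` records
that `p` reaches `q` off the hub, with at most `l` and a suitable `b` on the rim. For `l ∈ L` this
walk can replace a passage through the hub; for `l ∉ L` its absence forces the walk from the hub
through `l` and `b` to miss `q`. -/
theorem exists_starRel_of_out_of_in [Finite V] (hs : IsStarSystem r u N) {p q : V}
    (hp : ∀ p', r u p' ↔ p' = p) (hq : r q u) :
    ∃ A ⊆ N, ∀ x y, ReachLE (starRel r u N A) (Nᶜ.ncard + 4) x y := by
  obtain ⟨A, hA⟩ := hs.exists_isOutSet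
  set L : Set V := {l | l ∈ N ∧ l ∉ A ∧ Link r u N u l ∧
    ∃ b ∈ N, b ∉ A ∧ ¬ Link r u N u b ∧ Link r u N l b ∧
      ReachIn r (insert l (insert b (offStar u N))) p q}
  have hLN : L ⊆ N := fun l hl => hl.1
  refine ⟨A ∪ L, Set.union_subset hA.subset hLN, fun x y => ?_⟩
  have hpN := hs.out_mem p ((hp p).2 rfl)
  have hqN := hs.in_mem q hq
  have huP : ¬ r u u := fun h => (hs.out_mem u h).1 rfl
  have hu : ∀ F, u ∈ around N F := fun F h => absurd h hs.hub_notMem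
  obtain ⟨c, b, hg⟩ := from_hub hs L hA hLN y
  -- the hub is reached with two rim vertices, or by avoiding `p` and `q`, or by avoiding `q`, while
  -- `q` is reached without the hub
  have hto : (∃ a b, ReachIn (starRel r u N (A ∪ L)) (around N [a, b]) x u) ∨
      (∃ a b c, ReachIn (starRel r u N (A ∪ L)) (around N [a, b, c] \ {p, q}) x u) ∨
      (∃ a b c, ReachIn (starRel r u N (A ∪ L)) (around N [a, b, c] \ {q}) x u ∧
        ReachIn (starRel r u N (A ∪ L)) (around N [a, b, c] \ {u}) x q) := by
    by_cases hxu : x = u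
    · subst hxu
      exact .inl ⟨x, x, .refl (hu _)⟩
    -- three links into the rim avoid `q`, or the hub is reached with two rim vertices
    have three : ∀ (Z : Set V) (a a' d : V), a ∈ N → a' ∈ N → d ∈ N → (x ∈ N → x = a) →
        ReachIn r (insert x (insert a (offStar u N)) \ Z) x a →
        ReachIn r (insert a (insert a' (offStar u N)) \ Z) a a' →
        ReachIn r (insert a' (insert d (offStar u N)) \ Z) a' d →
        (∃ a b, ReachIn (starRel r u N (A ∪ L)) (around N [a, b]) x u) ∨
        ReachIn r ((around N [a, a', d] \ {q, u}) \ Z) x d := by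
      intro Z a a' d ha ha' hd hxa h1 h2 h3
      have hne : ∀ {v}, v ∈ N → v ≠ u := fun hv h => hs.hub_notMem (h ▸ hv)
      have hsub : ∀ {v w}, v ≠ u → w ∈ N → (v ∈ N → v ∈ [a, a', d]) → w ∈ [a, a', d] →
          (insert v (insert w (offStar u N)) \ Z) \ {q} ⊆ (around N [a, a', d] \ {q, u}) \ Z := by
        rintro v w hv hw hvF hwF t ⟨⟨ht, htZ⟩, htq⟩
        refine ⟨⟨?_, ?_⟩, htZ⟩
        · rcases ht with rfl | rfl | ht
          exacts [hvF, fun _ => hwF, fun h => absurd h ht.2]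
        · rintro (rfl | rfl)
          · exact htq rfl
          · rcases ht with rfl | rfl | ht
            exacts [hv rfl, hs.hub_notMem hw, ht.1 rfl]
      have hu' : ∀ {F : List V}, u ∈ N → u ∈ F := fun h => absurd h hs.hub_notMem
      have h1' : Link r u N x a := h1.mono_set Set.sdiff_subset
      have h2' : Link r u N a a' := h2.mono_set Set.sdiff_subset
      rcases hs.avoid_in h1 ha hq with k1 | k1
      swap
      · exact .inl ⟨a, a, k1.mono_around (fun h => by simp [hxa h]) hu'⟩
      have hxa' : ReachIn (starRel r u N (A ∪ L)) (around N [a, a']) x a :=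
        h1'.mono_around (fun h => by simp [hxa h]) (by simp)
      rcases hs.avoid_in h2 ha' hq with k2 | k2
      swap
      · exact .inl ⟨a, a', hxa'.trans (k2.mono_around (by simp) hu')⟩
      rcases hs.avoid_in h3 hd hq with k3 | k3
      swap
      · exact .inl ⟨a, a', hxa'.trans ((h2'.mono_around (by simp) (by simp)).trans
          (k3.mono_around (by simp) hu'))⟩
      exact .inr (((k1.mono_set (hsub hxu ha (fun h => by simp [hxa h]) (by simp))).trans
        (k2.mono_set (hsub (hne ha) ha' (by simp) (by simp)))).trans
        (k3.mono_set (hsub (hne ha') hd (by simp) (by simp))))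
    have back : ∀ {d}, d ∈ N → d ∉ A → ¬ Link r u N u d → starRel r u N (A ∪ L) d u :=
      fun hd hdA hud => .inr (.inr ⟨rfl, hd, fun h => h.elim hdA fun h => hud h.2.2.1⟩)
    rcases to_hub_cases hs (L := L) hA (fun l hl => ⟨hl.1, hl.2.1, hl.2.2.1, by
        obtain ⟨b, hb, hbA, hub, hlb, -⟩ := hl.2.2.2
        exact ⟨b, hb, hbA, hub, hlb⟩⟩) x with h |
      ⟨a, ha, a', ha', d, hd, hdA, hud, hxa, h1, h2, h3⟩ | ⟨v, hv, l, hl, hxv, h1, h2⟩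
    · exact .inl h
    · have haN := hA.subset ha
      have haN' := hA.subset ha'
      rcases three {p | r u p} a a' d haN haN' hd hxa (h1.avoid_out hs (hA.not_link a ha))
        (h2.avoid_out hs (hA.not_link a' ha')) (h3.avoid_out hs hud) with h | h
      · exact .inl h
      · refine .inr (.inl ⟨a, a', d, ReachIn.tail (h.mono ?_ fun _ _ => .inl) ?_
          (back hd hdA hud)⟩)
        · rintro t ⟨⟨ht, htq⟩, htp⟩
          exact ⟨ht, fun h => h.elim (fun h => htp ((hp t).2 h)) fun h => htq (.inl h)⟩
        · exact ⟨hu _, fun h => h.elim (fun h => hpN.1 h.symm) fun h => hqN.1 h.symm⟩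
    · obtain ⟨hlN, hlA, hul, b, hb, hbA, hub, hlb, hpq⟩ := hl
      have hemp : ∀ {x y}, Link r u N x y → ReachIn r (insert x (insert y (offStar u N)) \ ∅) x y :=
        fun h => h.mono_set (by simp)
      rcases three ∅ v l b (hA.subset hv) hlN hb hxv (hemp h1) (hemp h2) (hemp hlb) with h | h
      · exact .inl h
      · replace h := h.mono_set (Set.sdiff_subset)
        -- If the three links pass through `p`, the part up to `p` continues to `q` without the hub,
        -- by the walk recorded in `L`.
        rcases h.avoid_or_first {p} with h' | ⟨p, rfl, h'⟩
        · refine .inr (.inl ⟨v, l, b, ReachIn.tail (h'.mono ?_ fun _ _ => .inl) ?_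
            (back hb hbA hub)⟩)
          · rintro t ⟨⟨ht, htq⟩, htp⟩
            exact ⟨ht, fun h => h.elim htp fun h => htq (.inl h)⟩
          · exact ⟨hu _, fun h => h.elim (fun h => hpN.1 h.symm) fun h => hqN.1 h.symm⟩
        · refine .inr (.inr ⟨v, l, b, ReachIn.tail (h.mono ?_ fun _ _ => .inl) ?_
            (back hb hbA hub), ?_⟩)
          · exact fun t ht => ⟨ht.1, fun h => ht.2 (.inl h)⟩
          · exact ⟨hu _, fun h => hqN.1 h.symm⟩
          · refine (h'.mono ?_ fun _ _ => .inl).trans (hpq.mono ?_ fun _ _ => .inl)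
            · rintro t (rfl | ht)
              · exact ⟨fun h => absurd h hpN.2, hpN.1⟩
              · exact ⟨ht.1.1, fun h => ht.1.2 (.inr h)⟩
            · rintro t (rfl | rfl | ht)
              · exact ⟨fun _ => by simp, fun h => hs.hub_notMem (h ▸ hlN)⟩
              · exact ⟨fun _ => by simp, fun h => hs.hub_notMem (h ▸ hb)⟩
              · exact ⟨fun h => absurd h ht.2, ht.1⟩
  rcases hto with ⟨a, a', hf⟩ | ⟨a, a', d, hf⟩ | ⟨a, a', d, hf, hxq⟩
  · exact hf.reachLE_trans hg (by simp)
  · rcases from_hub_cases hs L hA hLN y with ⟨c, h⟩ | ⟨c, b, h⟩ |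
      ⟨l, hlN, hlA, hul, b, hb, hbA, hub, hlb, hyb, hby⟩
    · exact (hf.mono_set Set.sdiff_subset).reachLE_trans h (by simp)
    · exact hf.reachLE_trans_of_notMem h hpN.2 (.inl rfl) ((hp p).2 rfl) (by simp)
    have hr : ReachIn r (around N [l, b]) u y := by
      have hsub : ∀ {x y}, (x ∈ N → x ∈ [l, b]) → (y ∈ N → y ∈ [l, b]) →
          insert x (insert y (offStar u N)) ⊆ around N [l, b] := by
        rintro x y hx hy t (rfl | rfl | ht)
        exacts [hx, hy, fun h => absurd h ht.2]
      exact ((ReachIn.mono_set hul (hsub (fun h => absurd h hs.hub_notMem) (by simp))).trans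
        (ReachIn.mono_set hlb (hsub (by simp) (by simp)))).trans
        (ReachIn.mono_set hby (hsub (by simp) fun h => by simp [hyb h]))
    -- A visit to `q` is impossible here: as `p` is the only out-neighbour under `r`, the walk after
    -- its last departure from the hub would lead from `p` to `q` and put `l` into `L`.
    rcases hr.avoid_or_first {q} with h | ⟨q, rfl, h⟩
    · exact hf.reachLE_trans_of_notMem (h.mono_rel fun _ _ => .inl) hqN.2 (.inr rfl) rfl (by simp)
    · exfalso
      rcases h.cons_cases with rfl | ⟨z, hz, h1⟩
      · exact hqN.1 rfl
      rw [hp] at hz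
      subst hz
      refine hlA (.inr ⟨hlN, fun h => hlA (.inl h), hul, b, hb, hbA, hub, hlb, h1.mono_set ?_⟩)
      rintro t ⟨rfl | ⟨ht, -⟩, htu⟩
      · exact .inr (.inr hqN)
      · by_cases htN : t ∈ N
        · rcases List.mem_cons.1 (ht htN) with rfl | h
          · exact .inl rfl
          · exact .inr (.inl (by simpa using h))
        · exact .inr (.inr ⟨htu, htN⟩)
  -- If the last visit to `{u, q}` is at the hub, both halves miss `q`; if it is at `q`, the walk
  -- reaching `q` without the hub is used, and the hub is missed.
  · obtain ⟨z, hz, h⟩ := hg.exists_last (S := {u, q}) (.inl rfl)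
    rcases hz with rfl | rfl
    · refine hf.reachLE_trans_of_notMem (F' := [c, b]) (Z' := {q}) (h.mono_set ?_) hqN.2 rfl rfl (by simp)
      rintro t (rfl | ht)
      · exact ⟨hu _, fun h => hqN.1 h.symm⟩
      · exact ⟨ht.1, fun h => ht.2 (.inr h)⟩
    · refine hxq.reachLE_trans_of_notMem (F' := [c, b]) (Z' := {u}) (h.mono_set ?_) hs.hub_notMem rfl rfl (by simp)
      rintro t (rfl | ht)
      · exact ⟨fun h => absurd h hqN.2, hqN.1⟩
      · exact ⟨ht.1, fun h => ht.2 (.inl h)⟩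

end Star

/-! ### From bridgeless mixed graphs to star systems -/

namespace MixedGraph

variable {V : Type*}

/-- Undirected edges join the hub to the rim, so a walk to the hub uses only arcs up to its first
vertex in the hub or the rim. -/
theorem exists_arc_link [Finite V] {G : MixedGraph V} (hG : G.Connected) {u : V}
    (hstar : ∀ a b, G.und.Adj a b → a = u ∨ b = u) (x : V) :
    ∃ c ∈ insert u {y | G.und.Adj u y}, Link G.arc u {y | G.und.Adj u y} x c := by
  obtain ⟨c, hc, h⟩ := (ReachIn.of_reflTransGen ((connected_iff G).1 hG x u)).exists_first
    (S := insert u {y | G.und.Adj u y}) (.inl rfl)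
  refine ⟨c, hc, (h.mono_of_mem ?_).mono_set ?_⟩
  · have key : ∀ b, u ∈ insert c (Set.univ \ insert u {y | G.und.Adj u y}) →
        b ∈ insert c (Set.univ \ insert u {y | G.und.Adj u y}) → ¬ G.und.Adj u b := by
      intro b hu hb hub
      have h1 : u = c := hu.resolve_right fun h => h.2 (.inl rfl)
      have h2 : b = c := hb.resolve_right fun h => h.2 (.inr hub)
      exact G.und.loopless.irrefl u (by rwa [h2, ← h1] at hub)
    rintro a ha b hb (hab | hab)
    · rcases hstar a b hab with rfl | rfl
      · exact absurd hab (key b ha hb)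
      · exact absurd hab.symm (key a hb ha)
    · exact hab
  · rintro t (rfl | ht)
    · exact .inr (.inl rfl)
    · exact .inr (.inr ⟨fun h => ht.2 (.inl h), fun h => ht.2 (.inr h)⟩)

/-- A bridgeless mixed graph whose undirected edges are all incident with `u` gives a star
system. -/
theorem Bridgeless.isStarSystem [Finite V] {G : MixedGraph V} (hG : G.Bridgeless) {u : V}
    (hstar : ∀ a b, G.und.Adj a b → a = u ∨ b = u) :
    IsStarSystem G.arc u {y | G.und.Adj u y} := by
  have hto := exists_arc_link hG.1 hstar
  have hfrom : ∀ y, ∃ c ∈ insert u {y | G.und.Adj u y}, Link G.arc u {y | G.und.Adj u y} c y := by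
    intro y
    obtain ⟨c, hc, h⟩ := exists_arc_link hG.1.reverse hstar y
    exact ⟨c, hc, Link.flip h⟩
  set N : Set V := {y | G.und.Adj u y} with hN
  have huN : u ∉ N := G.und.loopless.irrefl u
  have hout : ∀ p, G.arc u p → p ∈ offStar u N := fun p hp =>
    ⟨fun h => G.arc_asymm u p hp (h ▸ h ▸ hp), G.arc_not_und u p hp⟩
  have hin : ∀ q, G.arc q u → q ∈ offStar u N := fun q hq =>
    ⟨fun h => G.arc_asymm q u hq (h ▸ h ▸ hq), fun h => G.arc_not_und q u hq h.symm⟩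
  refine ⟨huN, hout, hin, ?_, fun x _ => hto x, fun y _ => hfrom y⟩
  intro v hv
  by_contra! hcon
  -- Suppose `v` has no link to or from another vertex of the hub or the rim. Within `W`, the
  -- vertices reachable from `v` are those reaching `v`, and they form a set closed under adjacency
  -- once `uv` is deleted. It misses `u`, so `uv` would be a bridge.
  set W := insert v (offStar u N) with hW
  have huW : u ∉ W := by
    rintro (h | h)
    · exact huN (h ▸ hv)
    · exact h.1 rfl
  have hl1 : ∀ {w}, ReachIn G.arc (insert v W) v w → w ∈ insert u N → w = v := by
    intro w h hw
    by_contra hwv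
    refine (hcon w hw hwv).1 (h.mono_set ?_)
    rw [hW, Set.insert_eq_of_mem (Set.mem_insert _ _)]
    exact Set.insert_subset_insert (Set.subset_insert _ _)
  have hback : ∀ {z}, ReachIn G.arc W v z → ReachIn G.arc W z v := by
    intro z h
    by_cases hzv : z = v
    · rw [hzv]
      exact .refl (.inl rfl)
    have hzW : z ∈ offStar u N := h.mem_right.resolve_left hzv
    obtain ⟨c, hc, hl⟩ := hto z
    have hcv : c = v := by
      by_contra hcv
      refine (hcon c hc hcv).1 ((h.mono_set ?_).trans (ReachIn.mono_set hl ?_))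
      · exact Set.insert_subset_insert (Set.subset_insert _ _)
      · exact Set.insert_subset (.inr (.inr hzW)) (Set.subset_insert _ _)
    subst hcv
    exact ReachIn.mono_set hl (Set.insert_subset (.inr hzW) subset_rfl)
  have hforth : ∀ {z}, ReachIn G.arc W z v → ReachIn G.arc W v z := by
    intro z h
    by_cases hzv : z = v
    · rw [hzv]
      exact .refl (.inl rfl)
    have hzW : z ∈ offStar u N := h.mem_left.resolve_left hzv
    obtain ⟨c, hc, hl⟩ := hfrom z
    have hcv : c = v := by
      by_contra hcv
      refine (hcon c hc hcv).2 ((ReachIn.mono_set hl ?_).trans (h.mono_set ?_))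
      · exact Set.insert_subset_insert (Set.insert_subset (.inr hzW) (Set.subset_insert _ _))
      · exact Set.subset_insert _ _
    subst hcv
    refine ReachIn.mono_set hl (Set.insert_subset (.inl rfl) (Set.insert_subset (.inr hzW) ?_))
    exact Set.subset_insert _ _
  have hclosed : ∀ z z', (G.deleteUndEdge s(u, v)).underlying.Adj z z' → ReachIn G.arc W v z →
      ReachIn G.arc W v z' := by
    intro z z' hadj hz
    have hzu : z ≠ u := fun h => huW (h ▸ hz.mem_right)
    have hW' : ∀ {w}, w ∉ W → w ∈ insert u N ∧ w ≠ v := by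
      intro w hw
      refine ⟨?_, fun h => hw (.inl h)⟩
      by_contra hwN
      exact hw (.inr ⟨fun h => hwN (.inl h), fun h => hwN (.inr h)⟩)
    rcases hadj with h | h | h
    · exfalso
      obtain ⟨h1, h2⟩ := SimpleGraph.deleteEdges_adj.1 h
      obtain rfl := (hstar z z' h1).resolve_left hzu
      have : z = v := hz.mem_right.resolve_right fun h => h.2 h1.symm
      subst this
      exact h2 Sym2.eq_swap
    · by_cases hz' : z' ∈ W
      · exact hz.tail hz' h
      · exfalso
        obtain ⟨h1, h2⟩ := hW' hz'
        refine (hcon z' h1 h2).1 (ReachIn.tail (hz.mono_set ?_) (.inr (.inl rfl)) h)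
        exact Set.insert_subset_insert (Set.subset_insert _ _)
    · by_cases hz' : z' ∈ W
      · exact hforth (.head hz' h (hback hz))
      · exfalso
        obtain ⟨h1, h2⟩ := hW' hz'
        exact (hcon z' h1 h2).2 (.head (.inl rfl) h ((hback hz).mono_set (Set.subset_insert _ _)))
  have hc : (G.deleteUndEdge s(u, v)).underlying.Connected := by
    by_contra hc
    exact hG.2 s(u, v) ⟨hv, hc⟩
  have hwalk : ∀ {a b} (p : (G.deleteUndEdge s(u, v)).underlying.Walk a b),
      ReachIn G.arc W v a → ReachIn G.arc W v b := by
    intro a b p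
    induction p with
    | nil => exact id
    | cons h _ ih => exact fun ha => ih (hclosed _ _ h ha)
  obtain ⟨p⟩ := hc.preconnected v u
  exact huW (hwalk p (.refl (.inl rfl))).mem_right

theorem connected_of_reachLE [Finite V] {D : MixedGraph V} {k : ℕ}
    (h : ∀ x y, ReachLE D.arc k x y) : D.Connected := by
  rw [connected_iff]
  intro x y
  obtain ⟨T, hT, -⟩ := h x y
  exact hT.reflTransGen.lift id fun _ _ => .inr

theorem card_sub_undDeg [Fintype V] (G : MixedGraph V) (u : V) :
    ({y | G.und.Adj u y}ᶜ : Set V).ncard = Fintype.card V - G.undDeg u := by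
  rw [Set.ncard_compl, Nat.card_eq_fintype_card]
  rfl

theorem orientedDiam_le_of_reachLE [Finite V] {G D : MixedGraph V} {k : ℕ} (hD : D.Refines G)
    (hdir : D.IsDirected) (h : ∀ x y, ReachLE D.arc (k + 1) x y) : G.orientedDiam ≤ k := by
  refine orientedDiam_le_of_dist_le ⟨hD.isOrientation hdir, connected_of_reachLE h⟩ fun x y => ?_
  obtain ⟨T, hT, hk⟩ := h x y
  exact dist_le_of_reachIn hT hk

/-- The edges of a bridgeless mixed graph that are not incident with `u` can be directed such that
a star system remains. -/
theorem Bridgeless.exists_isStarSystem [Fintype V] {G : MixedGraph V} (hG : G.Bridgeless) (u : V) :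
    ∃ r : V → V → Prop, IsStarSystem r u {y | G.und.Adj u y} ∧ (∀ p, r u p ↔ G.arc u p) ∧
      (∀ p, r p u ↔ G.arc p u) ∧ ∀ A ⊆ {y | G.und.Adj u y}, ∀ k : ℕ,
        (∀ x y, ReachLE (starRel r u {y | G.und.Adj u y} A)
          (({y | G.und.Adj u y}ᶜ : Set V).ncard + (k + 1)) x y) →
        G.orientedDiam ≤ ((Fintype.card V - G.undDeg u + k : ℕ) : ℕ∞) := by
  -- Exactly the edges missing `u` are directed, so the undirected neighbourhood of `u` is
  -- unchanged.
  obtain ⟨D, hD, hDb, hadj⟩ := hG.exists_orient_set {e | u ∉ e}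
  have hadj' : ∀ a b, D.und.Adj a b ↔ G.und.Adj a b ∧ (a = u ∨ b = u) := by
    intro a b
    rw [hadj, Set.mem_ofPred_eq, not_not, Sym2.mem_iff, eq_comm, @eq_comm _ u b]
  have hN : {y | G.und.Adj u y} = {y | D.und.Adj u y} := by
    ext y
    simp [hadj']
  have hs := hDb.isStarSystem fun a b h => ((hadj' a b).1 h).2
  rw [← hN] at hs
  refine ⟨D.arc, hs, fun p => ⟨fun h => ?_, hD.arc_of_arc u p⟩,
    fun p => ⟨fun h => ?_, hD.arc_of_arc p u⟩, fun A hA k h => ?_⟩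
  · exact (hD.step_of_arc u p h).resolve_left fun h' =>
      D.arc_not_und u p h ((hadj' u p).2 ⟨h', .inl rfl⟩)
  · exact (hD.step_of_arc p u h).resolve_left fun h' =>
      D.arc_not_und p u h ((hadj' p u).2 ⟨h', .inr rfl⟩)
  · have ho : ∀ a b, ((a = u ∧ b ∈ A) ∨ (b = u ∧ a ∈ {y | G.und.Adj u y} ∧ a ∉ A)) →
        D.und.Adj a b := by
      rintro a b (⟨rfl, hb⟩ | ⟨rfl, ha, -⟩)
      · exact (hadj' a b).2 ⟨hA hb, .inl rfl⟩
      · exact (hadj' a b).2 ⟨ha.symm, .inr rfl⟩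
    have ha : ∀ a b, ((a = u ∧ b ∈ A) ∨ (b = u ∧ a ∈ {y | G.und.Adj u y} ∧ a ∉ A)) →
        ¬ ((b = u ∧ a ∈ A) ∨ (a = u ∧ b ∈ {y | G.und.Adj u y} ∧ b ∉ A)) := by
      rintro a b (⟨rfl, hb⟩ | ⟨rfl, ha, haA⟩) (⟨-, ha'⟩ | ⟨h1, h2, h3⟩)
      · exact hs.hub_notMem (hA ha')
      · exact h3 hb
      · exact haA ha'
      · exact hs.hub_notMem h2
    rw [card_sub_undDeg] at h
    -- The arcs of this orientation are `starRel` of `D.arc` by definition, so `h` applies as it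
    -- stands.
    refine orientedDiam_le_of_reachLE (D := D.orientBy _ ho ha)
      ((D.orientBy_refines _ ho ha).trans hD) ?_ h
    rintro a b ⟨hab, h1, h2⟩
    obtain ⟨hab', rfl | rfl⟩ := (hadj' a b).1 hab
    · by_cases hb : b ∈ A
      · exact h1 (.inl ⟨rfl, hb⟩)
      · exact h2 (.inr ⟨rfl, hab', hb⟩)
    · by_cases hb : a ∈ A
      · exact h2 (.inl ⟨rfl, hb⟩)
      · exact h1 (.inr ⟨rfl, hab'.symm, hb⟩)

theorem Bridgeless.orientedDiam_le_add_four [Fintype V] {G : MixedGraph V} (hG : G.Bridgeless)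
    (u : V) : G.orientedDiam ≤ ((Fintype.card V - G.undDeg u + 4 : ℕ) : ℕ∞) := by
  obtain ⟨r, hs, -, -, h⟩ := hG.exists_isStarSystem u
  obtain ⟨A, hA, hr⟩ := exists_starRel_le_add_five hs
  exact h A hA 4 hr

theorem Bridgeless.orientedDiam_le_of_two_le_outDeg [Fintype V] {G : MixedGraph V}
    (hG : G.Bridgeless) {u : V} (hu : 2 ≤ G.outDeg u) :
    G.orientedDiam ≤ ((Fintype.card V - G.undDeg u + 3 : ℕ) : ℕ∞) := by
  obtain ⟨r, hs, hout, -, h⟩ := hG.exists_isStarSystem u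
  obtain ⟨p, q, hp, hq, hpq⟩ := (Set.one_lt_ncard_iff (Set.toFinite _)).1 hu
  obtain ⟨A, hA, hr⟩ := exists_starRel_of_two_out hs hpq ((hout p).2 hp) ((hout q).2 hq)
  exact h A hA 3 hr

theorem Bridgeless.orientedDiam_le_of_outDeg_of_inDeg [Fintype V] {G : MixedGraph V}
    (hG : G.Bridgeless) {u : V} (hu : G.outDeg u = 1) (hu' : G.inDeg u ≠ 0) :
    G.orientedDiam ≤ ((Fintype.card V - G.undDeg u + 3 : ℕ) : ℕ∞) := by
  obtain ⟨r, hs, hout, hin, h⟩ := hG.exists_isStarSystem u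
  obtain ⟨p, hp⟩ := Set.ncard_eq_one.1 hu
  obtain ⟨q, hq⟩ := Set.nonempty_of_ncard_ne_zero hu'
  obtain ⟨A, hA, hr⟩ := exists_starRel_of_out_of_in hs (p := p)
    (fun p' => (hout p').trans (Set.ext_iff.1 hp p')) ((hin q).2 hq)
  exact h A hA 3 hr

theorem Bridgeless.orientedDiam_le_of_undDeg_eq_five [Fintype V] {G : MixedGraph V}
    (hG : G.Bridgeless) {u : V} (hu : G.outDeg u ≠ 0) (hu' : G.undDeg u = 5) :
    G.orientedDiam ≤ ((Fintype.card V - G.undDeg u + 3 : ℕ) : ℕ∞) := by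
  obtain ⟨r, hs, hout, -, h⟩ := hG.exists_isStarSystem u
  obtain ⟨p, hp⟩ := Set.nonempty_of_ncard_ne_zero hu
  obtain ⟨A, hA, hr⟩ := exists_starRel_of_out_of_ncard_eq hs ((hout p).2 hp) hu'
  exact h A hA 3 hr

/-- The bound for mixed graphs in which `u` is incident with directed edges. -/
theorem Bridgeless.orientedDiam_le_add_three [Fintype V] {G : MixedGraph V} (hG : G.Bridgeless)
    {u : V} (hu : 2 ≤ G.outDeg u + G.inDeg u ∨
      (G.undDeg u = 5 ∧ G.outDeg u + G.inDeg u = 1)) :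
    G.orientedDiam ≤ ((Fintype.card V - G.undDeg u + 3 : ℕ) : ℕ∞) := by
  have hrev : G.reverse.orientedDiam ≤ ((Fintype.card V - G.reverse.undDeg u + 3 : ℕ) : ℕ∞) →
      G.orientedDiam ≤ ((Fintype.card V - G.undDeg u + 3 : ℕ) : ℕ∞) :=
    fun h => G.orientedDiam_le_reverse.trans h
  have hout : G.reverse.outDeg u = G.inDeg u := rfl
  rcases hu with hu | ⟨h5, h1⟩
  · by_cases h2 : 2 ≤ G.outDeg u
    · exact hG.orientedDiam_le_of_two_le_outDeg h2
    by_cases h3 : 2 ≤ G.inDeg u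
    · exact hrev (hG.reverse.orientedDiam_le_of_two_le_outDeg h3)
    · exact hG.orientedDiam_le_of_outDeg_of_inDeg (by omega) (by omega)
  · by_cases h0 : G.outDeg u = 0
    · exact hrev (hG.reverse.orientedDiam_le_of_undDeg_eq_five (by omega) h5)
    · exact hG.orientedDiam_le_of_undDeg_eq_five h0 h5

end MixedGraph

/-! ### Ear systems for undirected graphs -/

section Undirected

variable {V : Type*}

/-- A partial orientation `o` of `G`, whose arcs lie in `S`, such that the vertices of `S` reach
`u` and are reached from `u` with few neighbours of `u` on the way. -/
structure IsEarSystem (G : SimpleGraph V) (u : V) (S : Set V) (o : V → V → Prop) : Prop where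
  hub_mem : u ∈ S
  arc : ∀ x y, o x y → x ∈ S ∧ y ∈ S ∧ G.Adj x y
  asymm : ∀ x y, o x y → ¬ o y x
  off_rim : ∀ x ∈ S, ¬ G.Adj u x → (∃ c, ReachIn o (around {y | G.Adj u y} [c]) x u) ∧
    ∃ c, ReachIn o (around {y | G.Adj u y} [c]) u x
  on_rim : ∀ x ∈ S, G.Adj u x →
    (o x u ∧ ∃ c, ReachIn o (around {y | G.Adj u y} [c, x]) u x) ∨
    (o u x ∧ ∃ c, ReachIn o (around {y | G.Adj u y} [c, x]) x u)

variable {G : SimpleGraph V} {u : V} {S : Set V} {o : V → V → Prop}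

theorem IsEarSystem.flip (h : IsEarSystem G u S o) : IsEarSystem G u S (fun a b => o b a) where
  hub_mem := h.hub_mem
  arc x y hxy := ⟨(h.arc y x hxy).2.1, (h.arc y x hxy).1, (h.arc y x hxy).2.2.symm⟩
  asymm x y hxy := h.asymm y x hxy
  off_rim x hx hxu := by
    obtain ⟨⟨c, hc⟩, d, hd⟩ := h.off_rim x hx hxu
    exact ⟨⟨d, hd.flip⟩, c, hc.flip⟩
  on_rim x hx hxu := by
    rcases h.on_rim x hx hxu with ⟨h1, c, hc⟩ | ⟨h1, c, hc⟩
    · exact .inr ⟨h1, c, hc.flip⟩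
    · exact .inl ⟨h1, c, hc.flip⟩

theorem isEarSystem_singleton : IsEarSystem G u {u} (fun _ _ => False) where
  hub_mem := rfl
  arc _ _ h := h.elim
  asymm _ _ h := h.elim
  off_rim := by
    rintro x rfl hx
    exact ⟨⟨x, .refl fun h => absurd h hx⟩, x, .refl fun h => absurd h hx⟩
  on_rim := by
    rintro x rfl hx
    exact absurd rfl hx.ne

/-- An ear system grows along a path from a new neighbour `v` of the hub, directed away from `v`. -/
theorem IsEarSystem.extend [Finite V] (h : IsEarSystem G u S o) {v s : V} {T : Set V}
    (hv : G.Adj u v) (hvS : v ∉ S) (hw : ReachIn G.Adj T v s)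
    (hTS : ∀ t ∈ T, t ≠ s → t ∉ S) (hTN : ∀ t ∈ T, G.Adj u t → t = v ∨ t = s) (hsv : s ≠ v)
    (hsu : s ≠ u) (hs : s ∈ S ∨ G.Adj u s) (hs' : s ∈ S → G.Adj u s → o s u) :
    ∃ S' o', insert v S ⊆ S' ∧ IsEarSystem G u S' o' := by
  obtain ⟨P, p, hPT, hvP, hsP, hp, hpa, hvs, hPs, hvP'⟩ := hw.exists_path
  have hne : v ≠ u := hv.ne'
  have huT : u ∉ P := fun hu => hTS u (hPT hu) hsu.symm h.hub_mem
  have huN : ¬ G.Adj u u := G.loopless.irrefl u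
  -- The ear runs from the hub to `v`, then along the path to `s`, and back to the hub directly if
  -- `s` is on the rim, or else along arcs of `o`.
  let o' : V → V → Prop := fun a b => o a b ∨ p a b ∨ (a = u ∧ b = v) ∨ (a = s ∧ b = u ∧ G.Adj u s)
  have hoo' : ∀ a b, o a b → o' a b := fun a b => .inl
  have hpo' : ∀ a b, p a b → o' a b := fun a b hab => .inr (.inl hab)
  have hou : o' u v := .inr (.inr (.inl ⟨rfl, rfl⟩))
  have huA : ∀ F, u ∈ around {y | G.Adj u y} F := fun F h => absurd h huN
  have hPF : ∀ {F : List V} {Z : Set V}, (v ∉ Z → v ∈ F) → (s ∉ Z → s ∈ F) →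
      P \ Z ⊆ around {y | G.Adj u y} F := by
    rintro F Z hvF hsF t ⟨ht, htZ⟩ htN
    rcases hTN t (hPT ht) htN with rfl | rfl
    · exact hvF htZ
    · exact hsF htZ
  -- the end of the path reaches the hub without further neighbours of the hub
  have hback : ∃ c, (G.Adj u s → c = s) ∧ ReachIn o' (around {y | G.Adj u y} [c]) s u := by
    by_cases hsN : G.Adj u s
    · exact ⟨s, fun _ => rfl, .single (fun _ => by simp) (huA _)
        (.inr (.inr (.inr ⟨rfl, rfl, hsN⟩)))⟩
    · obtain ⟨⟨c, hc⟩, -⟩ := h.off_rim s (hs.resolve_right hsN) hsN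
      exact ⟨c, fun h => absurd h hsN, hc.mono subset_rfl hoo'⟩
  obtain ⟨c, hcs, hc⟩ := hback
  have hPF' : ∀ {F : List V} {Z : Set V}, (v ∉ Z → v ∈ F) → c ∈ F →
      P \ Z ⊆ around {y | G.Adj u y} F := by
    rintro F Z hvF hcF t ⟨ht, htZ⟩ htN
    rcases hTN t (hPT ht) htN with rfl | rfl
    · exact hvF htZ
    · exact hcs htN ▸ hcF
  have hPS : ∀ t ∈ P, t ∈ S → t = s := fun t ht htS => by
    by_contra hts
    exact hTS t (hPT ht) hts htS
  refine ⟨S ∪ P, o', Set.insert_subset (.inr hvP) Set.subset_union_left, .inl h.hub_mem, ?_, ?_,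
    ?_, ?_⟩
  · rintro x y (hxy | hxy | ⟨rfl, rfl⟩ | ⟨rfl, rfl, hxy⟩)
    · obtain ⟨h1, h2, h3⟩ := h.arc x y hxy
      exact ⟨.inl h1, .inl h2, h3⟩
    · obtain ⟨h1, h2, h3⟩ := hp x y hxy
      exact ⟨.inr h1, .inr h2, h3⟩
    · exact ⟨.inl h.hub_mem, .inr hvP, hv⟩
    · exact ⟨.inr hsP, .inl h.hub_mem, hxy.symm⟩
  · have hop : ∀ x y, o x y → ¬ p y x := by
      intro x y h1 h2
      obtain ⟨hx, hy, hxy⟩ := h.arc x y h1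
      obtain ⟨hy', hx', -⟩ := hp y x h2
      exact hxy.ne ((hPS x hx' hx).trans (hPS y hy' hy).symm)
    -- The closing arc from `s` to `u` may already belong to `o`; `hs'` ensures that `o` does not
    -- contain its reverse.
    have hou' : ¬ o u s ∨ ¬ G.Adj u s := by
      by_contra! hcon
      exact h.asymm _ _ hcon.1 (hs' (h.arc u s hcon.1).2.1 hcon.2)
    rintro x y (h1 | h1 | ⟨rfl, rfl⟩ | ⟨rfl, rfl, h1⟩) (h2 | h2 | ⟨h2, h3⟩ | ⟨h2, h3, h4⟩)
    · exact h.asymm x y h1 h2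
    · exact hop x y h1 h2
    · exact hvS (h3 ▸ (h.arc x y h1).1)
    · subst h2 h3
      exact hou'.elim (fun h => h h1) fun h => h h4
    · exact hop y x h2 h1
    · exact hpa x y h1 h2
    · exact huT (h2 ▸ (hp x y h1).2.1)
    · exact huT (h3 ▸ (hp x y h1).1)
    · exact hvS (h.arc _ _ h2).1
    · exact huT (hp _ _ h2).2.1
    · exact hne h2
    · exact hsv h2.symm
    · exact hou'.elim (fun h => h h2) fun h => h h1
    · exact huT (hp _ _ h2).1
    · exact hsv h3
    · exact hsu h3
  · rintro x hx hxN
    by_cases hxS : x ∈ S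
    · obtain ⟨⟨c, hc⟩, d, hd⟩ := h.off_rim x hxS hxN
      exact ⟨⟨c, hc.mono subset_rfl hoo'⟩, d, hd.mono subset_rfl hoo'⟩
    have hxP : x ∈ P := hx.resolve_left hxS
    have hxv : x ≠ v := fun h => hxN (h ▸ hv)
    have hxs : x ≠ s := fun h => hs.elim (fun hs => hxS (h ▸ hs)) fun hs => hxN (h ▸ hs)
    refine ⟨⟨c, ReachIn.trans ((hPs x hxP hxv).mono ?_ hpo') hc⟩,
      v, .head (huA _) hou ((hvP' x hxP hxs).mono ?_ hpo')⟩
    · exact hPF' (fun h => absurd rfl h) (by simp)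
    · exact hPF (by simp) (fun h => absurd rfl h)
  · rintro x hx hxN
    by_cases hxS : x ∈ S
    · rcases h.on_rim x hxS hxN with ⟨h1, c, hc⟩ | ⟨h1, c, hc⟩
      · exact .inl ⟨hoo' _ _ h1, c, hc.mono subset_rfl hoo'⟩
      · exact .inr ⟨hoo' _ _ h1, c, hc.mono subset_rfl hoo'⟩
    have hxP : x ∈ P := hx.resolve_left hxS
    rcases hTN x (hPT hxP) hxN with rfl | rfl
    · refine .inr ⟨hou, c, ReachIn.trans (hvs.mono ?_ hpo') (hc.mono_set (around_mono (by simp)))⟩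
      rw [← Set.sdiff_empty (s := P)]
      exact hPF' (by simp) (by simp)
    · refine .inl ⟨.inr (.inr (.inr ⟨rfl, rfl, hxN⟩)), v, .head (huA _) hou (hvs.mono ?_ hpo')⟩
      rw [← Set.sdiff_empty (s := P)]
      exact hPF (by simp) (by simp)

/-- A neighbour `v` of `u` such that `uv` is not a bridge can be added to an ear system. -/
theorem IsEarSystem.exists_insert [Finite V] (h : IsEarSystem G u S o) {v : V} (hv : G.Adj u v)
    (hvS : v ∉ S) (hb : (G.deleteEdges {s(u, v)}).Reachable v u) :
    ∃ S' o', insert v S ⊆ S' ∧ IsEarSystem G u S' o' := by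
  have hvu : Relation.ReflTransGen (G.deleteEdges {s(u, v)}).Adj v u :=
    (SimpleGraph.reachable_iff_reflTransGen v u).1 hb
  -- The ear is cut at its first vertex in `Z`. This is not `u`, because `u` could only be entered
  -- from a rim vertex other than `v`, which itself lies in `Z`.
  set Z : Set V := (S ∪ {y | G.Adj u y}) \ {v} with hZ
  have huZ : u ∈ Z := ⟨.inl h.hub_mem, hv.ne⟩
  obtain ⟨s, hsZ, hw⟩ := (ReachIn.of_reflTransGen hvu).exists_first huZ
  have hsu : s ≠ u := by
    rintro rfl
    rcases Relation.ReflTransGen.cases_tail hw.2 with h1 | ⟨z, -, hz, -, hzs⟩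
    · exact hv.ne h1
    · obtain ⟨h1, h2⟩ := SimpleGraph.deleteEdges_adj.1 hzs
      rcases hz with rfl | hz
      · exact h1.ne rfl
      · refine hz.2 ⟨.inr h1.symm, ?_⟩
        rintro rfl
        exact h2 Sym2.eq_swap
  have hw' : ReachIn G.Adj (insert s (Set.univ \ Z)) v s :=
    hw.mono_rel fun a b hab => SimpleGraph.deleteEdges_le _ hab
  have hTS : ∀ t ∈ insert s (Set.univ \ Z), t ≠ s → t ∉ S := by
    rintro t (rfl | ht) hts htS
    · exact hts rfl
    · exact ht.2 ⟨.inl htS, fun h => hvS (h ▸ htS)⟩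
  have hTN : ∀ t ∈ insert s (Set.univ \ Z), G.Adj u t → t = v ∨ t = s := by
    rintro t (rfl | ht) htN
    · exact .inr rfl
    · by_contra! hcon
      exact ht.2 ⟨.inr htN, hcon.1⟩
  have hsv : s ≠ v := hsZ.2
  by_cases hcase : s ∈ S → G.Adj u s → o s u
  · exact h.extend hv hvS hw' hTS hTN hsv hsu hsZ.1 hcase
  -- The hub already points to `s`, so the ear must be directed the other way: the whole system is
  -- reversed before extending.
  · push Not at hcase
    obtain ⟨hsS, hsN, hso⟩ := hcase
    have hus : o u s := by
      rcases h.on_rim s hsS hsN with h1 | h1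
      · exact absurd h1.1 hso
      · exact h1.1
    obtain ⟨S', o', hS', ho'⟩ :=
      h.flip.extend hv hvS hw' hTS hTN hsv hsu hsZ.1 fun _ _ => hus
    exact ⟨S', _, hS', ho'⟩

/-- A maximal `S` contains the whole rim, since a missing neighbour would allow another ear. -/
theorem exists_isEarSystem [Finite V]
    (hb : ∀ v, G.Adj u v → (G.deleteEdges {s(u, v)}).Reachable v u) :
    ∃ S o, {y | G.Adj u y} ⊆ S ∧ IsEarSystem G u S o := by
  obtain ⟨S, hS⟩ := (Set.toFinite {S | ∃ o, IsEarSystem G u S o}).exists_maximal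
    ⟨_, _, isEarSystem_singleton⟩
  obtain ⟨o, ho⟩ := hS.1
  refine ⟨S, o, fun v hv => ?_, ho⟩
  by_contra hvS
  obtain ⟨S', o', hS', ho'⟩ := ho.exists_insert hv hvS (hb v hv)
  exact hvS (hS.2 ⟨o', ho'⟩ ((Set.subset_insert _ _).trans hS') (hS' (.inl rfl)))

/-- If `x` is on the rim, it is itself one of the two rim vertices counted, so prolonging the walk
at `x` off the rim costs nothing. -/
theorem IsEarSystem.exists_walks (h : IsEarSystem G u S o) {x : V} (hx : x ∈ S) :
    (∃ a b, (G.Adj u x → x = b) ∧ ReachIn o (around {y | G.Adj u y} [a, b]) x u) ∧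
      ∃ a b, (G.Adj u x → x = b) ∧ ReachIn o (around {y | G.Adj u y} [a, b]) u x := by
  have hu : ∀ F, u ∈ around {y | G.Adj u y} F := fun F h => absurd h (G.loopless.irrefl u)
  by_cases hxN : G.Adj u x
  · rcases h.on_rim x hx hxN with ⟨h1, c, hc⟩ | ⟨h1, c, hc⟩
    · exact ⟨⟨x, x, fun _ => rfl, .single (fun _ => by simp) (hu _) h1⟩, c, x, fun _ => rfl, hc⟩
    · exact ⟨⟨c, x, fun _ => rfl, hc⟩, x, x, fun _ => rfl, .single (hu _) (fun _ => by simp) h1⟩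
  · obtain ⟨⟨c, hc⟩, d, hd⟩ := h.off_rim x hx hxN
    exact ⟨⟨c, c, fun h => absurd h hxN, hc.mono_set (around_mono (by simp))⟩, d, d,
      fun h => absurd h hxN, hd.mono_set (around_mono (by simp))⟩

end Undirected

/-! ### The bound for undirected graphs -/

namespace MixedGraph

variable {V : Type*}

/-- Both ends of an edge directed by `o` lie in `S`, and any two vertices of `S` reach each other
through the hub, so passing it against its direction can be replaced by a walk. -/
theorem IsUndirected.connected_orientBy [Finite V] {G : MixedGraph V} (hU : G.IsUndirected)
    (hG : G.Connected) {u : V} {S : Set V} {o : V → V → Prop} (h : IsEarSystem G.und u S o)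
    (ho : ∀ x y, o x y → G.und.Adj x y) : (G.orientBy o ho h.asymm).Connected := by
  rw [connected_iff] at hG ⊢
  have hS : ∀ {x y}, x ∈ S → y ∈ S →
      Relation.ReflTransGen (G.orientBy o ho h.asymm).Step x y := by
    intro x y hx hy
    obtain ⟨⟨_, _, -, h1⟩, -⟩ := h.exists_walks hx
    obtain ⟨-, _, _, -, h2⟩ := h.exists_walks hy
    exact (h1.reflTransGen.trans h2.reflTransGen).lift id fun a b hab => .inr (.inr hab)
  intro x y
  have := hG x y
  induction this with
  | refl => exact .refl
  | @tail b c _ hbc ih =>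
    refine ih.trans ?_
    have hbc' : G.und.Adj b c := hbc.resolve_right (hU b c)
    by_cases h1 : o b c
    · exact hS (h.arc _ _ h1).1 (h.arc _ _ h1).2.1
    by_cases h2 : o c b
    · exact hS (h.arc _ _ h2).2.1 (h.arc _ _ h2).1
    · exact .single (.inl ⟨hbc', h1, h2⟩)

/-- The bound for undirected graphs. -/
theorem Bridgeless.orientedDiam_le_of_isUndirected [Fintype V] {G : MixedGraph V}
    (hG : G.Bridgeless) (hU : G.IsUndirected) (u : V) :
    G.orientedDiam ≤ ((Fintype.card V - G.undDeg u + 3 : ℕ) : ℕ∞) := by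
  have hb : ∀ v, G.und.Adj u v → (G.und.deleteEdges {s(u, v)}).Reachable v u := by
    intro v hv
    have hc : (G.deleteUndEdge s(u, v)).underlying.Connected := by
      by_contra hc
      exact hG.2 s(u, v) ⟨hv, hc⟩
    refine (hc.preconnected v u).mono ?_
    rintro a b (h | h | h)
    · exact h
    · exact absurd h (hU a b)
    · exact absurd h (hU b a)
  obtain ⟨S, o, hNS, h⟩ := exists_isEarSystem hb
  have ho : ∀ x y, o x y → G.und.Adj x y := fun x y hxy => (h.arc x y hxy).2.2
  have hM := G.orientBy_refines o ho h.asymm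
  obtain ⟨D, hD, hDb, hadj⟩ := (hM.bridgeless hG (hU.connected_orientBy hG.1 h ho)).exists_orient_set
    Set.univ
  have hdir : D.IsDirected := fun x y hxy => ((hadj x y).1 hxy).2 trivial
  have hoD : ∀ x y, o x y → D.arc x y := fun x y hxy => hD.arc_of_arc x y (.inr hxy)
  have huN : ¬ G.und.Adj u u := G.und.loopless.irrefl u
  have hDc : ∀ x y, Relation.ReflTransGen D.arc x y := fun x y =>
    ((connected_iff D).1 hDb.1 x y).lift id fun a b hab => hab.resolve_left (hdir a b)
  -- Outside the ears the orientation is uncontrolled, but a walk up to its first vertex in `R`, or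
  -- from its last one on, meets the rim at most in that vertex.
  set R : Set V := insert u {y | G.und.Adj u y} with hR
  have hRS : R ⊆ S := Set.insert_subset h.hub_mem hNS
  have hsub : ∀ {a b s : V}, s ∈ R → (G.und.Adj u s → s = b) →
      insert s (Set.univ \ R) ⊆ around {y | G.und.Adj u y} [a, b] := by
    rintro a b s hs hsb t (rfl | ht) htN
    · simp [hsb htN]
    · exact absurd (.inr htN) ht.2
  have hf : ∀ x, ∃ a b, ReachIn D.arc (around {y | G.und.Adj u y} [a, b]) x u := by
    intro x
    obtain ⟨s, hs, hw⟩ := (ReachIn.of_reflTransGen (hDc x u)).exists_first (S := R) (.inl rfl)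
    obtain ⟨⟨a, b, hsb, hab⟩, -⟩ := h.exists_walks (hRS hs)
    exact ⟨a, b, (hw.mono_set (hsub hs hsb)).trans (hab.mono_rel hoD)⟩
  have hg : ∀ y, ∃ a b, ReachIn D.arc (around {y | G.und.Adj u y} [a, b]) u y := by
    intro y
    obtain ⟨s, hs, hw⟩ := (ReachIn.of_reflTransGen (hDc u y)).exists_last (S := R) (.inl rfl)
    obtain ⟨-, a, b, hsb, hab⟩ := h.exists_walks (hRS hs)
    exact ⟨a, b, (hab.mono_rel hoD).trans (hw.mono_set (hsub hs hsb))⟩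
  refine orientedDiam_le_of_reachLE (hD.trans hM) hdir fun x y => ?_
  obtain ⟨a, b, h1⟩ := hf x
  obtain ⟨c, d, h2⟩ := hg y
  have := h1.reachLE_trans h2 (k := 4) (by simp)
  rwa [card_sub_undDeg] at this

end MixedGraph

theorem theorem1p3 {V : Type*} [Fintype V] (G : MixedGraph V) (hG : G.Bridgeless) (u : V) :
    ((G.IsUndirected ∨ 2 ≤ G.outDeg u + G.inDeg u ∨
        (G.undDeg u = 5 ∧ G.outDeg u + G.inDeg u = 1)) →
      G.orientedDiam ≤ ((Fintype.card V - G.undDeg u + 3 : ℕ) : ℕ∞)) ∧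
    (¬ (G.IsUndirected ∨ 2 ≤ G.outDeg u + G.inDeg u ∨
        (G.undDeg u = 5 ∧ G.outDeg u + G.inDeg u = 1)) →
      G.orientedDiam ≤ ((Fintype.card V - G.undDeg u + 4 : ℕ) : ℕ∞)) := by
  refine ⟨?_, fun _ => hG.orientedDiam_le_add_four u⟩
  rintro (h | h)
  · exact hG.orientedDiam_le_of_isUndirected h u
  · exact hG.orientedDiam_le_add_three h
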